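/- Let $(X_j,d_j)$ be a nonempty compact metric space and $Y_j$ a compact Hausdorff space for $j=1,2$, and let $C(Y_j)$ be the space of complex-valued continuous functions on $Y_j$ with the supremum norm. For $0<\alpha\le 1$ and a continuous map $F:X_j\to C(Y_j)$ put $\|F\|_\infty=\sup_{x\in X_j}\|F(x)\|$ and $$L_\alpha(F)=\sup_{x\ne x'}\frac{\|F(x)-F(x')\|}{d_j(x,x')^\alpha}$$ (the supremum of the empty set being $0$), and write $L=L_1$. Let $\mathrm{Lip}(X_j,C(Y_j))$ be the space of all continuous $F:X_j\to C(Y_j)$ with $L(F)<\infty$. For $0<\alpha<1$ let $\mathrm{lip}_\alpha(X_j,C(Y_j))$ be the space of all continuous $F:X_j\to C(Y_j)$ with $L_\alpha(F)<\infty$ and $$\lim_{x\to x_0}\frac{\|F(x_0)-F(x)\|}{d_j(x_0,x)^\alpha}=0\qquad\text{for every }x_0\in X_j.$$ Write $F(x,y)=(F(x))(y)$. Then a map $U:\mathrm{Lip}(X_1,C(Y_1))\to\mathrm{Lip}(X_2,C(Y_2))$ is a surjective complex-linear isometry with respect to the norms $\|\cdot\|_\infty+L(\cdot)$ if and only if there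 exist $h\in C(Y_2)$ with $|h|=1$ on $Y_2$, a continuous map $\varphi:X_2\times Y_2\to X_1$ such that $\varphi(\cdot,y):X_2\to X_1$ is a surjective isometry for every $y\in Y_2$, and a homeomorphism $\tau:Y_2\to Y_1$ such that $$U(F)(x,y)=h(y)\,F(\varphi(x,y),\tau(y)),\qquad (x,y)\in X_2\times Y_2,$$ for every $F\in\mathrm{Lip}(X_1,C(Y_1))$. Likewise, for every $0<\alpha<1$, a map $U:\mathrm{lip}_\alpha(X_1,C(Y_1))\to\mathrm{lip}_\alpha(X_2,C(Y_2))$ is a surjective complex-linear isometry with respect to the norms $\|\cdot\|_\infty+L_\alpha(\cdot)$ if and only if there exist $h$, $\varphi$, $\tau$ as above such that the same formula holds for every $F\in\mathrm{lip}_\alpha(X_1,C(Y_1))$. -/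

import Mathlib

open Set Filter Topology

/-- The set of difference quotients `‖F x - F y‖ / d(x, y) ^ α`, over `x ≠ y`. -/
def lipQuotients {K E : Type*} [MetricSpace K] [NormedAddCommGroup E]
    (α : ℝ) (F : C(K, E)) : Set ℝ :=
  {r | ∃ x y : K, x ≠ y ∧ r = ‖F x - F y‖ / dist x y ^ α}

/-- The `α`-Lipschitz number `L_α(F)`: the supremum of the difference quotients. It is used only
for maps whose difference quotients are bounded above (`L_α(F) < ∞`); it is `0` when `K` has at
most one point. -/
noncomputable def lipNumber {K E : Type*} [MetricSpace K] [NormedAddCommGroup E]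
    (α : ℝ) (F : C(K, E)) : ℝ :=
  sSup (lipQuotients α F)

/-- The Lipschitz space `Lip_α(K, E)`: the continuous maps with `L_α(F) < ∞`. -/
def LipSpace (α : ℝ) (K E : Type*) [MetricSpace K] [NormedAddCommGroup E] [NormedSpace ℂ E] :
    Submodule ℂ C(K, E) where
  carrier := {F | BddAbove (lipQuotients α F)}
  zero_mem' := by
    refine ⟨0, ?_⟩
    rintro r ⟨x, y, -, rfl⟩
    simp
  add_mem' := by
    rintro F G ⟨A, hA⟩ ⟨B, hB⟩
    refine ⟨A + B, ?_⟩
    rintro r ⟨x, y, hxy, rfl⟩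
    have h1 := hA ⟨x, y, hxy, rfl⟩
    have h2 := hB ⟨x, y, hxy, rfl⟩
    refine le_trans ?_ (add_le_add h1 h2)
    rw [← add_div]
    refine div_le_div_of_nonneg_right ?_ (Real.rpow_nonneg dist_nonneg α)
    simp only [ContinuousMap.add_apply]
    rw [add_sub_add_comm]
    exact norm_add_le _ _
  smul_mem' := by
    rintro c F ⟨A, hA⟩
    refine ⟨‖c‖ * A, ?_⟩
    rintro r ⟨x, y, hxy, rfl⟩
    have h1 := hA ⟨x, y, hxy, rfl⟩
    simp only [ContinuousMap.smul_apply]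
    rw [← smul_sub, norm_smul, mul_div_assoc]
    exact mul_le_mul_of_nonneg_left h1 (norm_nonneg c)

/-- The little Lipschitz space `lip_α(K, E)`: the maps `F` in `Lip_α(K, E)` such that
`‖F x₀ - F x‖ / d(x₀, x) ^ α → 0` as `x → x₀`, `x ≠ x₀`, for every `x₀` in `K`. -/
def LittleLipSpace (α : ℝ) (K E : Type*) [MetricSpace K] [NormedAddCommGroup E]
    [NormedSpace ℂ E] : Submodule ℂ C(K, E) where
  carrier := {F | F ∈ LipSpace α K E ∧
    ∀ x₀ : K, Tendsto (fun x => ‖F x₀ - F x‖ / dist x₀ x ^ α) (𝓝[≠] x₀) (𝓝 0)}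
  zero_mem' := ⟨zero_mem _, fun x₀ => by simpa using tendsto_const_nhds⟩
  add_mem' := by
    rintro F G ⟨hF, hF'⟩ ⟨hG, hG'⟩
    refine ⟨add_mem hF hG, fun x₀ => ?_⟩
    have h := (hF' x₀).add (hG' x₀)
    rw [add_zero] at h
    refine squeeze_zero (fun x => div_nonneg (norm_nonneg _) (Real.rpow_nonneg dist_nonneg α))
      (fun x => ?_) h
    rw [← add_div]
    refine div_le_div_of_nonneg_right ?_ (Real.rpow_nonneg dist_nonneg α)
    simp only [ContinuousMap.add_apply]
    rw [add_sub_add_comm]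
    exact norm_add_le _ _
  smul_mem' := by
    rintro c F ⟨hF, hF'⟩
    refine ⟨Submodule.smul_mem _ c hF, fun x₀ => ?_⟩
    have h := (hF' x₀).const_mul ‖c‖
    rw [mul_zero] at h
    refine h.congr fun x => ?_
    simp only [ContinuousMap.smul_apply]
    rw [← smul_sub, norm_smul, mul_div_assoc]

/-- The sum norm `‖F‖_∞ + L_α(F)`; `‖F‖` is the supremum norm of `C(K, E)`. -/
noncomputable def sumNorm {K E : Type*} [MetricSpace K] [CompactSpace K] [NormedAddCommGroup E]
    (α : ℝ) (F : C(K, E)) : ℝ :=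
  ‖F‖ + lipNumber α F

/-- `U` is a surjective complex-linear isometry between the spaces `A₁` and `A₂` of `E₁`- and
`E₂`-valued maps, both with the sum norm of exponent `α`. -/
def IsSurjectiveSumNormIsometry {K₁ K₂ E₁ E₂ : Type*}
    [MetricSpace K₁] [CompactSpace K₁] [MetricSpace K₂] [CompactSpace K₂]
    [NormedAddCommGroup E₁] [NormedSpace ℂ E₁] [NormedAddCommGroup E₂] [NormedSpace ℂ E₂]
    (α : ℝ) (A₁ : Submodule ℂ C(K₁, E₁)) (A₂ : Submodule ℂ C(K₂, E₂)) (U : A₁ → A₂) : Prop :=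
  IsLinearMap ℂ U ∧ Function.Surjective U ∧
    ∀ F : A₁, sumNorm α (U F : C(K₂, E₂)) = sumNorm α (F : C(K₁, E₁))

/-!
For the sum norm the constant function `1` is a spear: every `G` has a unimodular `c` with `‖G + c •
1‖ = ‖G‖ + 1`. Surjective linear isometries preserve spears, and a spear is a unimodular function
that is constant in `x`; hence `(U 1)(x, y) = h y`, and multiplying `U` by `star h` reduces to the
case `U 1 = 1`.

In that case `‖F + M • 1‖ - M` tends to `sup Re F + L(F)` as `M → ∞`, so `U` preserves this quantity
for all multiples of `F`. It follows that for real-valued `F` the image `U F` is real-valued with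
the same `L` and the same supremum, and peaking functions show that the evaluations of `U F` are
evaluations of `F`, which gives a homeomorphism of `X₂ × Y₂` onto `X₁ × Y₁`. Its second component
depends on `y` alone, because `L(F) = 0` exactly for the functions constant in `x`, and its first
component is isometric in `x`, because `U` preserves the Hölder constants of truncated distance
functions.

Conversely, if composition with `φ` preserves little Lipschitz functions, then `y ↦ φ (x, y)` is
locally constant for every `x`: otherwise a supremum of disjoint bumps centred at points
`φ (x, y n)` converging to `φ (x, y₀)` is a little Lipschitz function whose image is not one. The
inverse of `φ` is then locally constant in `y` too, so the inverse composition operator also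
preserves little Lipschitz functions.
-/

section LipNumber

variable {K E : Type*} [MetricSpace K] [NormedAddCommGroup E] {α : ℝ} {F G : C(K, E)}

theorem lipNumber_nonneg : 0 ≤ lipNumber α F :=
  Real.sSup_nonneg <| by rintro _ ⟨x, y, -, rfl⟩; positivity

theorem lipNumber_le {C : ℝ} (hC : 0 ≤ C) (h : ∀ x x', ‖F x - F x'‖ ≤ C * dist x x' ^ α) :
    lipNumber α F ≤ C :=
  Real.sSup_le (by rintro _ ⟨x, y, -, rfl⟩; exact div_le_of_le_mul₀ (by positivity) hC (h x y)) hC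

theorem lipNumber_const (e : E) : lipNumber α (ContinuousMap.const K e) = 0 :=
  le_antisymm (lipNumber_le le_rfl fun x x' ↦ by simp) lipNumber_nonneg

theorem lipNumber_add_const (e : E) :
    lipNumber α (F + ContinuousMap.const K e) = lipNumber α F := by
  simp [lipNumber, lipQuotients]

variable [NormedSpace ℂ E]

theorem mem_lipSpace_of_norm_sub_le {C : ℝ} (hC : 0 ≤ C)
    (h : ∀ x x', ‖F x - F x'‖ ≤ C * dist x x' ^ α) : F ∈ LipSpace α K E :=
  ⟨C, by rintro _ ⟨x, y, -, rfl⟩; exact div_le_of_le_mul₀ (by positivity) hC (h x y)⟩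

theorem norm_sub_le_lipNumber_mul (hF : F ∈ LipSpace α K E) (x x' : K) :
    ‖F x - F x'‖ ≤ lipNumber α F * dist x x' ^ α := by
  obtain rfl | hx := eq_or_ne x x'
  · simpa using mul_nonneg lipNumber_nonneg (Real.rpow_nonneg le_rfl α)
  · exact (div_le_iff₀ (Real.rpow_pos_of_pos (dist_pos.2 hx) α)).1 (le_csSup hF ⟨x, x', hx, rfl⟩)

theorem lipNumber_add_le (hF : F ∈ LipSpace α K E) (hG : G ∈ LipSpace α K E) :
    lipNumber α (F + G) ≤ lipNumber α F + lipNumber α G :=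
  lipNumber_le (add_nonneg lipNumber_nonneg lipNumber_nonneg) fun x x' ↦
    calc ‖(F + G) x - (F + G) x'‖ = ‖(F x - F x') + (G x - G x')‖ := by
          rw [ContinuousMap.add_apply, ContinuousMap.add_apply, add_sub_add_comm]
      _ ≤ lipNumber α F * dist x x' ^ α + lipNumber α G * dist x x' ^ α :=
          norm_add_le_of_le (norm_sub_le_lipNumber_mul hF x x') (norm_sub_le_lipNumber_mul hG x x')
      _ = (lipNumber α F + lipNumber α G) * dist x x' ^ α := (add_mul _ _ _).symm

open scoped Pointwise in
theorem lipNumber_smul (c : ℂ) (F : C(K, E)) : lipNumber α (c • F) = ‖c‖ * lipNumber α F := by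
  have hset : lipQuotients α (c • F) = ‖c‖ • lipQuotients α F := by
    ext r
    simp only [lipQuotients, ContinuousMap.smul_apply, ← smul_sub, norm_smul, mul_div_assoc,
      Set.mem_smul_set, Set.mem_ofPred_eq, smul_eq_mul]
    constructor
    · rintro ⟨x, y, hxy, rfl⟩
      exact ⟨_, ⟨x, y, hxy, rfl⟩, rfl⟩
    · rintro ⟨_, ⟨x, y, hxy, rfl⟩, rfl⟩
      exact ⟨x, y, hxy, rfl⟩
  rw [lipNumber, hset, Real.sSup_smul_of_nonneg (norm_nonneg c), smul_eq_mul, lipNumber]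

theorem sumNorm_smul [CompactSpace K] (c : ℂ) (F : C(K, E)) :
    sumNorm α (c • F) = ‖c‖ * sumNorm α F := by
  rw [sumNorm, sumNorm, norm_smul, lipNumber_smul, mul_add]

theorem sumNorm_eq_zero_iff [CompactSpace K] : sumNorm α F = 0 ↔ F = 0 := by
  refine ⟨fun h ↦ norm_eq_zero.1 ?_, fun h ↦ ?_⟩
  · have := lipNumber_nonneg (α := α) (F := F)
    have := norm_nonneg F
    unfold sumNorm at h
    linarith
  · rw [h, ← zero_smul ℂ (0 : C(K, E)), sumNorm_smul, norm_zero, zero_mul]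

end LipNumber

theorem le_rpow_one_sub_mul_rpow {t r d α : ℝ} (ht : 0 ≤ t) (htr : t ≤ r) (htd : t ≤ d)
    (hα : 0 ≤ α) (hα1 : α ≤ 1) : t ≤ r ^ (1 - α) * d ^ α :=
  calc t = t ^ (1 - α) * t ^ α := by
        rw [← Real.rpow_add' ht (by simp), sub_add_cancel, Real.rpow_one]
    _ ≤ r ^ (1 - α) * d ^ α := by
        have := ht.trans htr
        gcongr

section PointwiseLipschitz

variable {X Y : Type*} [MetricSpace X] [TopologicalSpace Y] [CompactSpace Y] {α : ℝ}
  {F : C(X, C(Y, ℂ))}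

theorem norm_apply_sub_le_lipNumber_mul (hF : F ∈ LipSpace α X C(Y, ℂ)) (x x' : X) (y : Y) :
    ‖F x y - F x' y‖ ≤ lipNumber α F * dist x x' ^ α :=
  ((F x - F x').norm_coe_le_norm y).trans (norm_sub_le_lipNumber_mul hF x x')

theorem norm_sub_le_of_apply {C : ℝ} (hC : 0 ≤ C)
    (h : ∀ x x' y, ‖F x y - F x' y‖ ≤ C * dist x x' ^ α) (x x' : X) :
    ‖F x - F x'‖ ≤ C * dist x x' ^ α :=
  (ContinuousMap.norm_le _ (by positivity)).2 (h x x')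

theorem lipNumber_add_smul_one (F : C(X, C(Y, ℂ))) (c : ℂ) :
    lipNumber α (F + c • 1) = lipNumber α F :=
  lipNumber_add_const (c • 1 : C(Y, ℂ))

end PointwiseLipschitz

section LittleLipschitz

open Asymptotics

variable {K E E' : Type*} [MetricSpace K] [NormedAddCommGroup E] [NormedSpace ℂ E]
  [NormedAddCommGroup E'] [NormedSpace ℂ E'] {α : ℝ} {F : C(K, E)} {G : C(K, E')}

theorem mem_littleLipSpace_iff_isLittleO :
    F ∈ LittleLipSpace α K E ↔ F ∈ LipSpace α K E ∧
      ∀ x₀, (fun x ↦ F x₀ - F x) =o[𝓝 x₀] fun x ↦ dist x₀ x ^ α := by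
  refine and_congr_right fun _ ↦ forall_congr' fun x₀ ↦ ?_
  rw [← nhdsNE_sup_pure x₀, isLittleO_sup, isLittleO_pure, and_iff_left (sub_self _),
    ← isLittleO_norm_left, isLittleO_iff_tendsto']
  filter_upwards [self_mem_nhdsWithin] with x hx h0 using
    absurd h0 (Real.rpow_pos_of_pos (dist_pos.2 (Ne.symm hx)) α).ne'

theorem littleLipSpace_le_lipSpace : LittleLipSpace α K E ≤ LipSpace α K E := fun _ hF ↦ hF.1

theorem mem_littleLipSpace_of_norm_sub_le (hF : F ∈ LittleLipSpace α K E)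
    (h : ∀ x x', ‖G x - G x'‖ ≤ ‖F x - F x'‖) : G ∈ LittleLipSpace α K E' := by
  rw [mem_littleLipSpace_iff_isLittleO] at hF ⊢
  exact ⟨mem_lipSpace_of_norm_sub_le lipNumber_nonneg fun x x' ↦
      (h x x').trans (norm_sub_le_lipNumber_mul hF.1 x x'),
    fun x₀ ↦ (IsBigO.of_bound' (.of_forall fun x ↦ h x₀ x)).trans_isLittleO (hF.2 x₀)⟩

theorem tendsto_dist_rpow (hα : 0 < α) (x₀ : K) :
    Tendsto (fun x ↦ dist x₀ x ^ α) (𝓝 x₀) (𝓝 0) := by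
  have hcont : ContinuousAt (fun x ↦ dist x₀ x ^ α) x₀ :=
    (continuous_const.dist continuous_id).continuousAt.rpow_const (.inr hα.le)
  simpa [ContinuousAt, Real.zero_rpow hα.ne'] using hcont

theorem isLittleO_dist_rpow (hα1 : α < 1) (x₀ : K) :
    (fun x ↦ dist x₀ x) =o[𝓝 x₀] fun x ↦ dist x₀ x ^ α := by
  have hmul := ((isLittleO_one_iff ℝ).2 (tendsto_dist_rpow (sub_pos.2 hα1) x₀)).mul_isBigO
    (isBigO_refl (fun x ↦ dist x₀ x ^ α) (𝓝 x₀))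
  refine hmul.congr (fun x ↦ ?_) fun x ↦ one_mul _
  rw [← Real.rpow_add' dist_nonneg (by simp), sub_add_cancel, Real.rpow_one]

end LittleLipschitz

section LipschitzType

open scoped NNReal

variable {X Y : Type*} [MetricSpace X] [TopologicalSpace Y]

/-- Pointwise composition `(x, y) ↦ k (F x y)` with a continuous function `k` on the plane. -/
noncomputable def postComp (k : C(ℂ, ℂ)) (F : C(X, C(Y, ℂ))) : C(X, C(Y, ℂ)) :=
  ⟨fun x ↦ k.comp (F x), k.continuous_postcomp.comp F.continuous⟩

/-- A scalar function on `X`, viewed as a function on `X × Y` that does not depend on `Y`. -/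
noncomputable def ofFst (Y : Type*) [TopologicalSpace Y] (f : C(X, ℂ)) : C(X, C(Y, ℂ)) :=
  ContinuousMap.const'.comp f

@[simp]
theorem postComp_apply (k : C(ℂ, ℂ)) (F : C(X, C(Y, ℂ))) (x : X) (y : Y) :
    postComp k F x y = k (F x y) := rfl

@[simp]
theorem ofFst_apply (f : C(X, ℂ)) (x : X) (y : Y) : ofFst Y f x y = f x := rfl

variable [CompactSpace Y] {α : ℝ} {A : Submodule ℂ C(X, C(Y, ℂ))} {F G : C(X, C(Y, ℂ))}

/-- The properties shared by `LipSpace` and `LittleLipSpace` on which the description of their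
isometries rests: domination by the increments of a member suffices for membership, and so does
the Lipschitz condition of exponent `1`. -/
structure IsLipschitzType (α : ℝ) (A : Submodule ℂ C(X, C(Y, ℂ))) : Prop where
  le_lipSpace : A ≤ LipSpace α X C(Y, ℂ)
  mem_of_norm_sub_le : ∀ {F G : C(X, C(Y, ℂ))}, F ∈ A →
    (∀ x x', ‖G x - G x'‖ ≤ ‖F x - F x'‖) → G ∈ A
  mem_of_lipschitzWith : ∀ {F : C(X, C(Y, ℂ))} {κ : ℝ≥0}, LipschitzWith κ F → F ∈ A

theorem isLipschitzType_lipSpace [CompactSpace X] (hα : 0 < α) (hα1 : α ≤ 1) :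
    IsLipschitzType α (LipSpace α X C(Y, ℂ)) where
  le_lipSpace := le_rfl
  mem_of_norm_sub_le hF h := mem_lipSpace_of_norm_sub_le lipNumber_nonneg fun x x' ↦
    (h x x').trans (norm_sub_le_lipNumber_mul hF x x')
  mem_of_lipschitzWith {F κ} hF :=
    mem_lipSpace_of_norm_sub_le (C := κ * Metric.diam (univ : Set X) ^ (1 - α)) (by positivity)
      fun x x' ↦ by
        have hdiam := Metric.dist_le_diam_of_mem isCompact_univ.isBounded (mem_univ x) (mem_univ x')
        rw [← dist_eq_norm, mul_assoc]
        exact (hF.dist_le_mul x x').trans <| mul_le_mul_of_nonneg_left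
          (le_rpow_one_sub_mul_rpow dist_nonneg hdiam le_rfl hα.le hα1) κ.2

theorem isLipschitzType_littleLipSpace [CompactSpace X] (hα : 0 < α) (hα1 : α < 1) :
    IsLipschitzType α (LittleLipSpace α X C(Y, ℂ)) where
  le_lipSpace := littleLipSpace_le_lipSpace
  mem_of_norm_sub_le := mem_littleLipSpace_of_norm_sub_le
  mem_of_lipschitzWith {F κ} hF := mem_littleLipSpace_iff_isLittleO.2
    ⟨(isLipschitzType_lipSpace hα hα1.le).mem_of_lipschitzWith hF, fun x₀ ↦
      (Asymptotics.IsBigO.of_bound κ (.of_forall fun x ↦ by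
        simpa [dist_eq_norm] using hF.dist_le_mul x₀ x)).trans_isLittleO
        (isLittleO_dist_rpow hα1 x₀)⟩

namespace IsLipschitzType

theorem const_mem (hA : IsLipschitzType α A) (g : C(Y, ℂ)) : ContinuousMap.const X g ∈ A :=
  hA.mem_of_lipschitzWith (LipschitzWith.const g)

theorem one_mem (hA : IsLipschitzType α A) : (1 : C(X, C(Y, ℂ))) ∈ A :=
  hA.const_mem 1

theorem ofFst_mem (hA : IsLipschitzType α A) {f : C(X, ℂ)} {κ : ℝ≥0} (hf : LipschitzWith κ f) :
    ofFst Y f ∈ A :=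
  hA.mem_of_lipschitzWith (κ := κ) <| LipschitzWith.of_dist_le_mul fun x x' ↦
    (ContinuousMap.dist_le (by positivity)).2 fun _ ↦ hf.dist_le_mul x x'

end IsLipschitzType

theorem norm_postComp_sub_le {k : C(ℂ, ℂ)} {κ : ℝ≥0} (hk : LipschitzWith κ k)
    (F : C(X, C(Y, ℂ))) (x x' : X) :
    ‖postComp k F x - postComp k F x'‖ ≤ κ * ‖F x - F x'‖ :=
  (ContinuousMap.norm_le _ (by positivity)).2 fun y ↦
    calc ‖k (F x y) - k (F x' y)‖ ≤ κ * ‖F x y - F x' y‖ := hk.norm_sub_le _ _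
      _ ≤ κ * ‖F x - F x'‖ := by
        gcongr
        exact (F x - F x').norm_coe_le_norm y

theorem IsLipschitzType.postComp_mem (hA : IsLipschitzType α A) {k : C(ℂ, ℂ)} {κ : ℝ≥0}
    (hk : LipschitzWith κ k) (hF : F ∈ A) : postComp k F ∈ A :=
  hA.mem_of_norm_sub_le (A.smul_mem (κ : ℂ) hF) fun x x' ↦ by
    simpa [← smul_sub, norm_smul] using norm_postComp_sub_le hk F x x'

theorem postComp_mem_lipSpace {k : C(ℂ, ℂ)} {κ : ℝ≥0} (hk : LipschitzWith κ k)
    (hF : F ∈ LipSpace α X C(Y, ℂ)) : postComp k F ∈ LipSpace α X C(Y, ℂ) :=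
  mem_lipSpace_of_norm_sub_le (mul_nonneg κ.2 lipNumber_nonneg) fun x x' ↦ by
    rw [mul_assoc]
    exact (norm_postComp_sub_le hk F x x').trans
      (mul_le_mul_of_nonneg_left (norm_sub_le_lipNumber_mul hF x x') κ.2)

end LipschitzType

theorem exists_real_separating {Y : Type*} [TopologicalSpace Y] [CompactSpace Y] [T2Space Y]
    {y y' : Y} (h : y ≠ y') : ∃ g : C(Y, ℂ), (∀ z, (g z).im = 0) ∧ g y = 0 ∧ g y' = 1 := by
  obtain ⟨g, h0, h1, -⟩ := exists_continuous_zero_one_of_isClosed isClosed_singleton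
    isClosed_singleton (disjoint_singleton.2 h)
  refine ⟨⟨fun z ↦ (g z : ℂ), by fun_prop⟩, fun z ↦ Complex.ofReal_im _, ?_, ?_⟩
  · simpa using h0 (mem_singleton y)
  · simpa using h1 (mem_singleton y')

section SupNorm

variable {X Y : Type*} [TopologicalSpace X] [TopologicalSpace Y] {F G : C(X, C(Y, ℂ))}

/-- The maximum over `X × Y` of the real part of `F`: the one-sided part of `‖F‖` that remains
after a large constant is added to `F`. -/
noncomputable def reMax (F : C(X, C(Y, ℂ))) : ℝ := ⨆ p : X × Y, (F p.1 p.2).re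

/-- All values of `F` on `X × Y` are real. -/
def IsRealValued (F : C(X, C(Y, ℂ))) : Prop := ∀ x y, (F x y).im = 0

theorem reMax_le [Nonempty X] [Nonempty Y] {C : ℝ} (h : ∀ x y, (F x y).re ≤ C) : reMax F ≤ C :=
  ciSup_le fun p ↦ h p.1 p.2

theorem reMax_congr (h : ∀ x y, (F x y).re = (G x y).re) : reMax F = reMax G :=
  congrArg iSup (funext fun p ↦ h p.1 p.2)

variable [CompactSpace X] [CompactSpace Y]

theorem norm_apply_apply_le (F : C(X, C(Y, ℂ))) (x : X) (y : Y) : ‖F x y‖ ≤ ‖F‖ :=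
  ((F x).norm_coe_le_norm y).trans (F.norm_coe_le_norm x)

theorem norm_le_of_apply_apply {C : ℝ} (hC : 0 ≤ C) (h : ∀ x y, ‖F x y‖ ≤ C) : ‖F‖ ≤ C :=
  (ContinuousMap.norm_le _ hC).2 fun x ↦ (ContinuousMap.norm_le _ hC).2 (h x)

theorem re_le_reMax (F : C(X, C(Y, ℂ))) (x : X) (y : Y) : (F x y).re ≤ reMax F :=
  le_ciSup (f := fun p : X × Y ↦ (F p.1 p.2).re)
    (isCompact_range (by fun_prop)).bddAbove (x, y)

variable [Nonempty X] [Nonempty Y]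

theorem exists_norm_apply_apply_eq (F : C(X, C(Y, ℂ))) : ∃ x y, ‖F x y‖ = ‖F‖ := by
  obtain ⟨p, -, hp⟩ := isCompact_univ.exists_isMaxOn univ_nonempty
    (f := fun p : X × Y ↦ ‖F p.1 p.2‖) (by fun_prop)
  exact ⟨p.1, p.2, (norm_apply_apply_le F _ _).antisymm <|
    norm_le_of_apply_apply (norm_nonneg _) fun x y ↦ hp (mem_univ (x, y))⟩

theorem exists_re_eq_reMax (F : C(X, C(Y, ℂ))) : ∃ x y, (F x y).re = reMax F := by
  obtain ⟨p, hp⟩ := (isCompact_range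
    (f := fun p : X × Y ↦ (F p.1 p.2).re) (by fun_prop)).sSup_mem (range_nonempty _)
  exact ⟨p.1, p.2, hp⟩

theorem reMax_add_le (F G : C(X, C(Y, ℂ))) : reMax (F + G) ≤ reMax F + reMax G :=
  reMax_le fun x y ↦ add_le_add (re_le_reMax F x y) (re_le_reMax G x y)

theorem norm_eq_of_apply_apply {C : ℝ} (h : ∀ x y, ‖F x y‖ = C) : ‖F‖ = C := by
  obtain ⟨x, y, hxy⟩ := exists_norm_apply_apply_eq F
  rw [← hxy, h]

theorem IsRealValued.reMax_smul (hF : IsRealValued F) {z : ℂ} (hz : 0 ≤ z.re) :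
    reMax (z • F) = z.re * reMax F := by
  have hre : ∀ x y, ((z • F) x y).re = z.re * (F x y).re := fun x y ↦ by simp [hF x y]
  obtain ⟨x, y, hxy⟩ := exists_re_eq_reMax F
  refine le_antisymm (reMax_le fun x y ↦ ?_) ?_
  · rw [hre]
    exact mul_le_mul_of_nonneg_left (re_le_reMax F x y) hz
  · rw [← hxy, ← hre]
    exact re_le_reMax (z • F) x y

theorem exists_sameRay_of_norm_add_eq (h : ‖F + G‖ = ‖F‖ + ‖G‖) :
    ∃ x y, ‖F x y‖ = ‖F‖ ∧ ‖G x y‖ = ‖G‖ ∧ SameRay ℝ (F x y) (G x y) := by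
  obtain ⟨x, y, hxy⟩ := exists_norm_apply_apply_eq (F + G)
  have hadd : ‖F x y + G x y‖ = ‖F‖ + ‖G‖ := hxy.trans h
  have hF := norm_apply_apply_le F x y
  have hG := norm_apply_apply_le G x y
  have htri := norm_add_le (F x y) (G x y)
  exact ⟨x, y, by linarith, by linarith, sameRay_iff_norm_add.2 (by linarith)⟩

theorem reMax_add_le_norm_add_smul_one (F : C(X, C(Y, ℂ))) (M : ℝ) :
    reMax F + M ≤ ‖F + (M : ℂ) • 1‖ := by
  obtain ⟨x, y, hxy⟩ := exists_re_eq_reMax F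
  calc reMax F + M = (((F + (M : ℂ) • 1) x y).re) := by simp [hxy]
    _ ≤ ‖(F + (M : ℂ) • 1) x y‖ := Complex.re_le_norm _
    _ ≤ ‖F + (M : ℂ) • 1‖ := norm_apply_apply_le _ x y

theorem neg_norm_le_reMax (F : C(X, C(Y, ℂ))) : -‖F‖ ≤ reMax F := by
  obtain ⟨x, y, hxy⟩ := exists_re_eq_reMax F
  rw [← hxy]
  exact (neg_le_neg (norm_apply_apply_le F x y)).trans (neg_le_of_abs_le (Complex.abs_re_le_norm _))

theorem norm_add_smul_one_le {M : ℝ} (hM : ‖F‖ < M) :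
    ‖F + (M : ℂ) • 1‖ ≤ reMax F + M + ‖F‖ ^ 2 / (reMax F + M) := by
  have hpos : 0 < reMax F + M := by linarith [neg_norm_le_reMax F]
  refine norm_le_of_apply_apply (by positivity) fun x y ↦
    abs_le_of_sq_le_sq' ?_ (by positivity) |>.2
  have hnorm := norm_apply_apply_le F x y
  have hre : (F x y).re + M ≤ reMax F + M := by linarith [re_le_reMax F x y]
  have hre' : 0 ≤ (F x y).re + M := by
    linarith [neg_le_of_abs_le (Complex.abs_re_le_norm (F x y))]
  calc ‖(F + (M : ℂ) • 1) x y‖ ^ 2 = ((F x y).re + M) ^ 2 + (F x y).im ^ 2 := by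
        simp [Complex.sq_norm, Complex.normSq_apply]
        ring
    _ ≤ (reMax F + M) ^ 2 + ‖F‖ ^ 2 := by
        have him := (Complex.abs_im_le_norm (F x y)).trans hnorm
        gcongr ?_ ^ 2 + ?_
        exact sq_le_sq' (neg_le_of_abs_le him) (le_of_abs_le him)
    _ ≤ (reMax F + M + ‖F‖ ^ 2 / (reMax F + M)) ^ 2 := by
        rw [add_sq (reMax F + M), mul_assoc 2, mul_div_cancel₀ _ hpos.ne']
        nlinarith [sq_nonneg ‖F‖, sq_nonneg (‖F‖ ^ 2 / (reMax F + M))]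

theorem tendsto_norm_add_smul_one_sub (F : C(X, C(Y, ℂ))) :
    Tendsto (fun M : ℝ ↦ ‖F + (M : ℂ) • 1‖ - M) atTop (𝓝 (reMax F)) := by
  have hlim : Tendsto (fun M ↦ reMax F + ‖F‖ ^ 2 / (reMax F + M)) atTop (𝓝 (reMax F)) := by
    simpa using tendsto_const_nhds.add
      (tendsto_const_nhds.div_atTop (tendsto_atTop_add_const_left atTop (reMax F) tendsto_id))
  refine tendsto_of_tendsto_of_tendsto_of_le_of_le' tendsto_const_nhds hlim
    (.of_forall fun M ↦ by linarith [reMax_add_le_norm_add_smul_one F M]) ?_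
  filter_upwards [eventually_gt_atTop ‖F‖] with M hM
  linarith [norm_add_smul_one_le hM]

end SupNorm

theorem star_mul_self_of_norm_eq_one {z : ℂ} (hz : ‖z‖ = 1) : star z * z = 1 := by
  rw [Complex.star_def, Complex.conj_mul', hz, Complex.ofReal_one, one_pow]

section WeightedComposition

variable {X₁ X₂ Y₁ Y₂ : Type*} [MetricSpace X₁] [MetricSpace X₂]
  [TopologicalSpace Y₁] [TopologicalSpace Y₂]

/-- Each partial map `φ(·, y)` is a surjective isometry: the condition on the first component of
the change of variables in a weighted composition operator. -/
def IsFiberwiseIsometry (φ : C(X₂ × Y₂, X₁)) : Prop :=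
  ∀ y, Isometry (fun x ↦ φ (x, y)) ∧ Function.Surjective fun x ↦ φ (x, y)

theorem isFiberwiseIsometry_fst : IsFiberwiseIsometry (ContinuousMap.fst : C(X₁ × Y₁, X₁)) :=
  fun _ ↦ ⟨isometry_id, Function.surjective_id⟩

theorem IsFiberwiseIsometry.exists_inverse {φ : C(X₂ × Y₂, X₁)} (hφ : IsFiberwiseIsometry φ) :
    ∃ ψ : C(X₁ × Y₂, X₂), IsFiberwiseIsometry ψ ∧ ∀ x y, ψ (φ (x, y), y) = x := by
  choose ψ hφψ using fun p : X₁ × Y₂ ↦ (hφ p.2).2 p.1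
  simp only [Prod.forall] at hφψ
  have hψφ : ∀ x y, ψ (φ (x, y), y) = x := fun x y ↦ (hφ y).1.injective (hφψ _ y)
  have hcont : Continuous ψ := by
    refine continuous_iff_continuousAt.2 fun ⟨a, y⟩ ↦ tendsto_iff_dist_tendsto_zero.2 ?_
    have hdist : ∀ p : X₁ × Y₂, dist (ψ p) (ψ (a, y)) = dist p.1 (φ (ψ (a, y), p.2)) := fun p ↦ by
      rw [← (hφ p.2).1.dist_eq, hφψ]
    have hlim : Continuous fun p : X₁ × Y₂ ↦ dist p.1 (φ (ψ (a, y), p.2)) := by fun_prop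
    simpa only [hdist, hφψ, dist_self] using hlim.tendsto (a, y)
  refine ⟨⟨ψ, hcont⟩, fun y ↦ ⟨Isometry.of_dist_eq fun a b ↦ ?_, fun x ↦ ⟨_, hψφ x y⟩⟩, hψφ⟩
  simpa only [hφψ, ContinuousMap.coe_mk] using ((hφ y).1.dist_eq (ψ (a, y)) (ψ (b, y))).symm

variable [CompactSpace Y₁] [CompactSpace Y₂] {α : ℝ}

/-- The weighted composition operator `F ↦ h(y) F(φ(x, y), τ(y))`. -/
noncomputable def weightedComp (h : C(Y₂, ℂ)) (φ : C(X₂ × Y₂, X₁)) (τ : C(Y₂, Y₁)) :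
    C(X₁, C(Y₁, ℂ)) →ₗ[ℂ] C(X₂, C(Y₂, ℂ)) where
  toFun F := ContinuousMap.curry ⟨fun p ↦ h p.2 * F (φ p) (τ p.2), by fun_prop⟩
  map_add' F G := by ext x y; simp [mul_add]
  map_smul' c F := by ext x y; simp [mul_left_comm]

section

variable {h : C(Y₂, ℂ)} {φ : C(X₂ × Y₂, X₁)} {τ : C(Y₂, Y₁)} {F : C(X₁, C(Y₁, ℂ))}

theorem weightedComp_apply (h : C(Y₂, ℂ)) (φ : C(X₂ × Y₂, X₁)) (τ : C(Y₂, Y₁))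
    (F : C(X₁, C(Y₁, ℂ))) (x : X₂) (y : Y₂) :
    weightedComp h φ τ F x y = h y * F (φ (x, y)) (τ y) := rfl

theorem norm_weightedComp_apply (hh : ∀ y, ‖h y‖ = 1) (x : X₂) (y : Y₂) :
    ‖weightedComp h φ τ F x y‖ = ‖F (φ (x, y)) (τ y)‖ := by
  rw [weightedComp_apply, norm_mul, hh, one_mul]

theorem norm_weightedComp_sub_apply (hh : ∀ y, ‖h y‖ = 1) (x x' : X₂) (y : Y₂) :
    ‖weightedComp h φ τ F x y - weightedComp h φ τ F x' y‖ =
      ‖F (φ (x, y)) (τ y) - F (φ (x', y)) (τ y)‖ := by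
  rw [weightedComp_apply, weightedComp_apply, ← mul_sub, norm_mul, hh, one_mul]

theorem norm_weightedComp_sub_le (hh : ∀ y, ‖h y‖ = 1) (hφ : IsFiberwiseIsometry φ)
    (hF : F ∈ LipSpace α X₁ C(Y₁, ℂ)) (x x' : X₂) :
    ‖weightedComp h φ τ F x - weightedComp h φ τ F x'‖ ≤ lipNumber α F * dist x x' ^ α :=
  norm_sub_le_of_apply lipNumber_nonneg (fun x x' y ↦ by
    rw [norm_weightedComp_sub_apply hh, ← (hφ y).1.dist_eq x x']
    exact norm_apply_sub_le_lipNumber_mul hF _ _ _) x x'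

theorem weightedComp_mem_lipSpace (hh : ∀ y, ‖h y‖ = 1) (hφ : IsFiberwiseIsometry φ)
    (hF : F ∈ LipSpace α X₁ C(Y₁, ℂ)) : weightedComp h φ τ F ∈ LipSpace α X₂ C(Y₂, ℂ) :=
  mem_lipSpace_of_norm_sub_le lipNumber_nonneg (norm_weightedComp_sub_le hh hφ hF)

theorem lipNumber_weightedComp (hh : ∀ y, ‖h y‖ = 1) (hφ : IsFiberwiseIsometry φ)
    (hτ : Function.Surjective τ) (hF : F ∈ LipSpace α X₁ C(Y₁, ℂ)) :
    lipNumber α (weightedComp h φ τ F) = lipNumber α F := by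
  refine le_antisymm (lipNumber_le lipNumber_nonneg (norm_weightedComp_sub_le hh hφ hF)) <|
    lipNumber_le lipNumber_nonneg <| norm_sub_le_of_apply lipNumber_nonneg fun a a' y₁ ↦ ?_
  obtain ⟨y, rfl⟩ := hτ y₁
  obtain ⟨x, rfl⟩ := (hφ y).2 a
  obtain ⟨x', rfl⟩ := (hφ y).2 a'
  rw [← norm_weightedComp_sub_apply hh, (hφ y).1.dist_eq]
  exact norm_apply_sub_le_lipNumber_mul (weightedComp_mem_lipSpace hh hφ hF) x x' y

theorem norm_weightedComp [CompactSpace X₁] [CompactSpace X₂] (hh : ∀ y, ‖h y‖ = 1)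
    (hφ : IsFiberwiseIsometry φ) (hτ : Function.Surjective τ) :
    ‖weightedComp h φ τ F‖ = ‖F‖ := by
  refine le_antisymm (norm_le_of_apply_apply (norm_nonneg F) fun x y ↦ ?_)
    (norm_le_of_apply_apply (norm_nonneg _) fun a y₁ ↦ ?_)
  · rw [norm_weightedComp_apply hh]
    exact norm_apply_apply_le F _ _
  · obtain ⟨y, rfl⟩ := hτ y₁
    obtain ⟨x, rfl⟩ := (hφ y).2 a
    rw [← norm_weightedComp_apply hh]
    exact norm_apply_apply_le _ x y

end

theorem exists_weightedComp_inverse {h : C(Y₂, ℂ)} {φ : C(X₂ × Y₂, X₁)}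
    (hh : ∀ y, ‖h y‖ = 1) (hφ : IsFiberwiseIsometry φ) (τ : Y₂ ≃ₜ Y₁) :
    ∃ (k : C(Y₁, ℂ)) (ψ : C(X₁ × Y₁, X₂)), (∀ y, ‖k y‖ = 1) ∧ IsFiberwiseIsometry ψ ∧
      (∀ x y, ψ (φ (x, y), τ y) = x) ∧
      ∀ W, weightedComp h φ τ (weightedComp k ψ τ.symm W) = W := by
  obtain ⟨ψ, hψ, hψφ⟩ := hφ.exists_inverse
  refine ⟨(star h).comp τ.symm, ψ.comp ⟨fun p ↦ (p.1, τ.symm p.2), by fun_prop⟩,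
    fun y ↦ by simp [hh], fun y ↦ hψ (τ.symm y), fun x y ↦ by simp [hψφ], fun W ↦ ?_⟩
  ext x y
  simp only [weightedComp_apply, ContinuousMap.comp_apply, ContinuousMap.coe_mk,
    ContinuousMap.star_apply, Homeomorph.symm_apply_apply, hψφ]
  rw [← mul_assoc, mul_comm (h y), star_mul_self_of_norm_eq_one (hh y), one_mul]

/-- `U` is the weighted composition operator with a unimodular weight `h` and a fiberwise
isometric `φ`, restricted to the spaces `A₁` and `A₂`. -/
def IsWeightedComposition {A₁ : Submodule ℂ C(X₁, C(Y₁, ℂ))} {A₂ : Submodule ℂ C(X₂, C(Y₂, ℂ))}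
    (U : A₁ → A₂) (h : C(Y₂, ℂ)) (φ : C(X₂ × Y₂, X₁)) (τ : Y₂ ≃ₜ Y₁) : Prop :=
  (∀ y, ‖h y‖ = 1) ∧ IsFiberwiseIsometry φ ∧
    ∀ (F : A₁) (x : X₂) (y : Y₂), (U F).1 x y = h y * F.1 (φ (x, y)) (τ y)

variable {A₁ : Submodule ℂ C(X₁, C(Y₁, ℂ))} {A₂ : Submodule ℂ C(X₂, C(Y₂, ℂ))}
  {U : A₁ → A₂} {h : C(Y₂, ℂ)} {φ : C(X₂ × Y₂, X₁)} {τ : Y₂ ≃ₜ Y₁}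

theorem IsWeightedComposition.coe_apply (hU : IsWeightedComposition U h φ τ) (F : A₁) :
    (U F).1 = weightedComp h φ τ F.1 :=
  ContinuousMap.ext fun x ↦ ContinuousMap.ext fun y ↦ hU.2.2 F x y

theorem IsWeightedComposition.isSurjectiveSumNormIsometry [CompactSpace X₁] [CompactSpace X₂]
    (hU : IsWeightedComposition U h φ τ) (hA₁ : A₁ ≤ LipSpace α X₁ C(Y₁, ℂ))
    (hsurj : ∀ W ∈ A₂, ∃ F ∈ A₁, weightedComp h φ τ F = W) :
    IsSurjectiveSumNormIsometry α A₁ A₂ U := by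
  refine ⟨⟨fun F G ↦ Subtype.ext ?_, fun c F ↦ Subtype.ext ?_⟩, fun W ↦ ?_, fun F ↦ ?_⟩
  · simp only [hU.coe_apply, Submodule.coe_add, map_add]
  · simp only [hU.coe_apply, Submodule.coe_smul, map_smul]
  · obtain ⟨F, hF, hFW⟩ := hsurj W W.2
    exact ⟨⟨F, hF⟩, Subtype.ext ((hU.coe_apply _).trans hFW)⟩
  · rw [sumNorm, sumNorm, hU.coe_apply, norm_weightedComp hU.1 hU.2.1 τ.surjective,
      lipNumber_weightedComp hU.1 hU.2.1 τ.surjective (hA₁ F.2)]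

end WeightedComposition

section DiffQuot

variable {X Y : Type*} [MetricSpace X] [TopologicalSpace Y] {α : ℝ} {F : C(X, C(Y, ℂ))}

/-- The difference quotient of `F` with exponent `α`. It is `0` for `x = x'`. -/
noncomputable def diffQuot (α : ℝ) (F : C(X, C(Y, ℂ))) (x x' : X) (y : Y) : ℂ :=
  (dist x x' ^ α)⁻¹ • (F x y - F x' y)

/-- The closure of the set of all difference quotients of `F`. Its compactness makes up for the
fact that the supremum defining the Lipschitz number need not be attained. -/
noncomputable def diffQuotClosure (α : ℝ) (F : C(X, C(Y, ℂ))) : Set ℂ :=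
  closure (range fun p : X × X × Y ↦ diffQuot α F p.1 p.2.1 p.2.2)

theorem diffQuot_postComp (k : ℂ →L[ℝ] ℂ) (F : C(X, C(Y, ℂ))) (x x' : X) (y : Y) :
    diffQuot α (postComp k F) x x' y = k (diffQuot α F x x' y) := by
  simp only [diffQuot, postComp_apply, ContinuousMap.coe_coe, map_smul, map_sub]

theorem norm_sub_eq_norm_diffQuot_mul (F : C(X, C(Y, ℂ))) (x x' : X) (y : Y) :
    ‖F x y - F x' y‖ = ‖diffQuot α F x x' y‖ * dist x x' ^ α := by
  obtain rfl | hx := eq_or_ne x x'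
  · simp [diffQuot]
  · have := Real.rpow_pos_of_pos (dist_pos.2 hx) α
    rw [diffQuot, norm_smul, norm_inv, Real.norm_of_nonneg this.le]
    field_simp

variable [CompactSpace Y]

theorem norm_diffQuot_le (hF : F ∈ LipSpace α X C(Y, ℂ)) (x x' : X) (y : Y) :
    ‖diffQuot α F x x' y‖ ≤ lipNumber α F := by
  obtain rfl | hx := eq_or_ne x x'
  · simpa [diffQuot] using lipNumber_nonneg
  · refine le_of_mul_le_mul_right ?_ (Real.rpow_pos_of_pos (dist_pos.2 hx) α)
    rw [← norm_sub_eq_norm_diffQuot_mul]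
    exact norm_apply_sub_le_lipNumber_mul hF x x' y

theorem isCompact_diffQuotClosure (hF : F ∈ LipSpace α X C(Y, ℂ)) :
    IsCompact (diffQuotClosure α F) :=
  (isBounded_iff_forall_norm_le.2 ⟨lipNumber α F, by
    rintro _ ⟨p, rfl⟩; exact norm_diffQuot_le hF _ _ _⟩).isCompact_closure

theorem norm_le_lipNumber_postComp (k : ℂ →L[ℝ] ℂ) (hF : F ∈ LipSpace α X C(Y, ℂ)) {d : ℂ}
    (hd : d ∈ diffQuotClosure α F) : ‖k d‖ ≤ lipNumber α (postComp k F) := by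
  refine closure_minimal ?_ (isClosed_le (by fun_prop) continuous_const :
    IsClosed {d | ‖k d‖ ≤ lipNumber α (postComp k F)}) hd
  rintro _ ⟨p, rfl⟩
  rw [mem_ofPred_eq, ← diffQuot_postComp]
  exact norm_diffQuot_le (postComp_mem_lipSpace k.lipschitz hF) _ _ _

theorem exists_norm_eq_lipNumber_postComp [Nonempty X] [Nonempty Y] (k : ℂ →L[ℝ] ℂ)
    (hF : F ∈ LipSpace α X C(Y, ℂ)) :
    ∃ d ∈ diffQuotClosure α F, ‖k d‖ = lipNumber α (postComp k F) := by
  obtain ⟨d, hd, hmax⟩ := (isCompact_diffQuotClosure hF).exists_isMaxOn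
    (range_nonempty _).closure (f := fun d ↦ ‖k d‖) (by fun_prop)
  refine ⟨d, hd, (norm_le_lipNumber_postComp k hF hd).antisymm <|
    lipNumber_le (norm_nonneg _) <| norm_sub_le_of_apply (norm_nonneg _) fun x x' y ↦ ?_⟩
  rw [norm_sub_eq_norm_diffQuot_mul, diffQuot_postComp]
  gcongr
  exact hmax (subset_closure ⟨(x, x', y), rfl⟩)

end DiffQuot

/-- The real part, as a real-linear map from the plane to itself. -/
noncomputable def rePart : ℂ →L[ℝ] ℂ := Complex.ofRealCLM ∘L Complex.reCLM

@[simp]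
theorem rePart_apply (z : ℂ) : rePart z = z.re := rfl

section Spear

variable {X Y : Type*} [MetricSpace X] [CompactSpace X] [TopologicalSpace Y] [CompactSpace Y]
  {α : ℝ} {A : Submodule ℂ C(X, C(Y, ℂ))} {u G : C(X, C(Y, ℂ))}

/-- A spear of a space with the sum norm: a unit vector `u` such that every `G` satisfies
`‖G + c u‖ = ‖G‖ + 1` for some unimodular scalar `c`. Surjective linear isometries preserve this
property. -/
structure IsSpear (α : ℝ) (A : Submodule ℂ C(X, C(Y, ℂ))) (u : C(X, C(Y, ℂ))) : Prop where
  mem : u ∈ A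
  sumNorm_eq : sumNorm α u = 1
  exists_sumNorm_add_eq : ∀ G ∈ A, ∃ c : ℂ, ‖c‖ = 1 ∧ sumNorm α (G + c • u) = sumNorm α G + 1

theorem sumNorm_one [Nonempty X] [Nonempty Y] : sumNorm α (1 : C(X, C(Y, ℂ))) = 1 := by
  rw [sumNorm, norm_eq_of_apply_apply fun _ _ ↦ norm_one]
  simpa using lipNumber_const (1 : C(Y, ℂ))

theorem exists_norm_add_smul_one_eq [Nonempty X] [Nonempty Y] (G : C(X, C(Y, ℂ))) :
    ∃ c : ℂ, ‖c‖ = 1 ∧ ‖G + c • 1‖ = ‖G‖ + 1 := by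
  obtain ⟨x, y, hxy⟩ := exists_norm_apply_apply_eq G
  obtain ⟨c, hc, hcG⟩ := RCLike.exists_norm_mul_eq_self (G x y)
  refine ⟨c, hc, le_antisymm ?_ ?_⟩
  · refine (norm_add_le _ _).trans_eq ?_
    rw [norm_smul, hc, norm_eq_of_apply_apply (F := 1) fun _ _ ↦ norm_one, mul_one]
  · calc ‖G‖ + 1 = ‖c * ((‖G x y‖ + 1 : ℝ) : ℂ)‖ := by
          rw [norm_mul, hc, Complex.norm_of_nonneg (by positivity), hxy, one_mul]
      _ = ‖(G + c • 1) x y‖ := by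
          congr 1
          simpa [mul_add] using hcG
      _ ≤ ‖G + c • 1‖ := norm_apply_apply_le _ x y

theorem isSpear_one [Nonempty X] [Nonempty Y] (hA : IsLipschitzType α A) : IsSpear α A 1 where
  mem := hA.one_mem
  sumNorm_eq := sumNorm_one
  exists_sumNorm_add_eq G _ := by
    obtain ⟨c, hc, hnorm⟩ := exists_norm_add_smul_one_eq G
    exact ⟨c, hc, by rw [sumNorm, sumNorm, hnorm, lipNumber_add_smul_one]; ring⟩

namespace IsSpear

theorem map {X' Y' : Type*} [MetricSpace X'] [CompactSpace X'] [TopologicalSpace Y']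
    [CompactSpace Y'] {A' : Submodule ℂ C(X', C(Y', ℂ))} {u : A} (hu : IsSpear α A u)
    {U : A → A'} (hU : IsSurjectiveSumNormIsometry α A A' U) : IsSpear α A' (U u).1 where
  mem := (U u).2
  sumNorm_eq := (hU.2.2 u).trans hu.sumNorm_eq
  exists_sumNorm_add_eq G hG := by
    obtain ⟨F, hF⟩ := hU.2.1 ⟨G, hG⟩
    obtain ⟨c, hc, hadd⟩ := hu.exists_sumNorm_add_eq F F.2
    refine ⟨c, hc, ?_⟩
    have hG : G = (U F).1 := by rw [hF]
    have hmap : G + c • (U u).1 = (U (F + c • u)).1 := by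
      rw [hU.1.map_add, hU.1.map_smul, hG]; rfl
    rw [hmap, hG, hU.2.2, hU.2.2]
    exact hadd

theorem smul (hu : IsSpear α A u) {μ : ℂ} (hμ : ‖μ‖ = 1) : IsSpear α A (μ • u) where
  mem := A.smul_mem μ hu.mem
  sumNorm_eq := by rw [sumNorm_smul, hμ, one_mul, hu.sumNorm_eq]
  exists_sumNorm_add_eq G hG := by
    obtain ⟨c, hc, hadd⟩ := hu.exists_sumNorm_add_eq G hG
    have hμ0 : μ ≠ 0 := norm_ne_zero_iff.1 (hμ ▸ one_ne_zero)
    exact ⟨c * μ⁻¹, by simp [hc, hμ], by rwa [smul_smul, inv_mul_cancel_right₀ hμ0]⟩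

theorem exists_add_eq (hu : IsSpear α A u) (hA : A ≤ LipSpace α X C(Y, ℂ)) (hG : G ∈ A) :
    ∃ c : ℂ, ‖c‖ = 1 ∧ ‖G + c • u‖ = ‖G‖ + ‖u‖ ∧
      lipNumber α (G + c • u) = lipNumber α G + lipNumber α u := by
  obtain ⟨c, hc, hadd⟩ := hu.exists_sumNorm_add_eq G hG
  have hnorm := norm_add_le G (c • u)
  have hlip := lipNumber_add_le (hA hG) (hA (A.smul_mem c hu.mem))
  rw [norm_smul, hc, one_mul] at hnorm
  rw [lipNumber_smul, hc, one_mul] at hlip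
  rw [← hu.sumNorm_eq, sumNorm, sumNorm, sumNorm] at hadd
  exact ⟨c, hc, by linarith, by linarith⟩

theorem norm_lt_one_of_lipNumber_ne_zero (hu : IsSpear α A u) (h : lipNumber α u ≠ 0) :
    ‖u‖ < 1 := by
  have hpos : 0 < lipNumber α u := lipNumber_nonneg.lt_of_ne' h
  have hsum := hu.sumNorm_eq
  unfold sumNorm at hsum
  linarith

variable [Nonempty X] [Nonempty Y]

theorem norm_apply_apply (hu : IsSpear α A u) (hA : IsLipschitzType α A) (x : X) (y : Y) :
    ‖u x y‖ = ‖u‖ := by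
  let k : C(ℂ, ℂ) := ⟨fun z ↦ ((‖u‖ - ‖z‖ : ℝ) : ℂ), by fun_prop⟩
  have hk : LipschitzWith 1 k := LipschitzWith.of_dist_le_mul fun z w ↦ by
    rw [NNReal.coe_one, one_mul, dist_comm z, ContinuousMap.coe_mk,
      Complex.isometry_ofReal.dist_eq, Real.dist_eq, sub_sub_sub_cancel_left]
    exact (abs_norm_sub_norm_le w z).trans_eq (dist_eq_norm w z).symm
  obtain ⟨c, hc, hadd, -⟩ := hu.exists_add_eq hA.le_lipSpace (hA.postComp_mem hk hu.mem)
  rw [← one_mul ‖u‖, ← hc, ← norm_smul] at hadd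
  obtain ⟨a, b, hk_norm, hu_norm, -⟩ := exists_sameRay_of_norm_add_eq hadd
  have hu_norm : ‖u a b‖ = ‖u‖ := by simpa [norm_smul, hc] using hu_norm
  have hk_zero : ‖postComp k u‖ = 0 := by rw [← hk_norm]; simp [k, hu_norm]
  have hxy : ‖postComp k u x y‖ = 0 := by rw [norm_eq_zero.1 hk_zero]; simp
  have : ‖u‖ - ‖u x y‖ = 0 := by simpa [k, ← Complex.ofReal_sub] using hxy
  linarith

end IsSpear

end Spear

theorem eq_I_of_lipNumber_add_eq {X Y : Type*} [MetricSpace X] [TopologicalSpace Y]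
    [CompactSpace Y] [Nonempty X] [Nonempty Y] {α : ℝ} {v : C(X, C(Y, ℂ))}
    (hv : v ∈ LipSpace α X C(Y, ℂ)) (hv0 : lipNumber α v ≠ 0) {c : ℂ} (hc : ‖c‖ = 1)
    (h : lipNumber α (Complex.I • postComp rePart v + c • v) = 2 * lipNumber α v) :
    c = Complex.I := by
  let k : ℂ →L[ℝ] ℂ := Complex.I • rePart + ContinuousLinearMap.mul ℝ ℂ c
  have hk : postComp k v = Complex.I • postComp rePart v + c • v := rfl
  obtain ⟨d, hd, hdk⟩ := exists_norm_eq_lipNumber_postComp k hv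
  have hdL : ‖d‖ ≤ lipNumber α v := norm_le_lipNumber_postComp (.id ℝ ℂ) hv hd
  have hre : ‖Complex.I * (d.re : ℂ)‖ = |d.re| := by simp
  have hcd : ‖c * d‖ = ‖d‖ := by rw [norm_mul, hc, one_mul]
  have hsum : ‖Complex.I * d.re + c * d‖ = 2 * lipNumber α v := by rw [← h, ← hk, ← hdk]; rfl
  have htri := norm_add_le (Complex.I * (d.re : ℂ)) (c * d)
  have hredL := Complex.abs_re_le_norm d
  have hreal : |d.re| = ‖d‖ := by linarith
  have hd0 : d ≠ 0 := fun hd0 ↦ hv0 (by simpa [hd0] using hsum.symm)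
  have hd_re : (d.re : ℂ) = d :=
    Complex.ext rfl (by simpa using (Complex.abs_re_eq_norm.1 hreal).symm)
  -- `‖i Re d + c d‖ = 2 L` with `‖d‖ ≤ L` makes both summands agree, by strict convexity.
  have hsame : Complex.I * (d.re : ℂ) = c * d :=
    eq_of_norm_eq_of_norm_add_eq (by rw [hre, hcd, hreal]) (by linarith)
  rw [hd_re] at hsame
  exact (mul_right_cancel₀ hd0 hsame).symm

theorem re_eq_zero_of_sameRay {z : ℂ} (hz : ‖z‖ < 1)
    (h : SameRay ℝ (Complex.I * z.re + 1) (Complex.I * z)) : z.re = 0 := by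
  by_contra hre
  have hnorm : ‖Complex.I * z.re + 1‖ = ‖z‖ := by
    have him := congrArg Complex.im (sameRay_iff_norm_smul_eq.1 h)
    simpa [hre] using him
  have hone : 1 ≤ ‖Complex.I * z.re + 1‖ := by
    simpa using Complex.re_le_norm (Complex.I * z.re + 1)
  linarith

namespace IsSpear

variable {X Y : Type*} [MetricSpace X] [CompactSpace X] [TopologicalSpace Y] [CompactSpace Y]
  {α : ℝ} {A : Submodule ℂ C(X, C(Y, ℂ))} {u v : C(X, C(Y, ℂ))} [Nonempty X] [Nonempty Y]

theorem lipNumber_eq_zero_of_lipNumber_re_eq (hv : IsSpear α A v) (hA : IsLipschitzType α A)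
    (h : lipNumber α (postComp rePart v) = lipNumber α v) : lipNumber α v = 0 := by
  by_contra hv0
  let G : C(X, C(Y, ℂ)) := Complex.I • postComp rePart v + (1 : ℂ) • 1
  have hG : G ∈ A := A.add_mem (A.smul_mem _ (hA.postComp_mem rePart.lipschitz hv.mem))
    (A.smul_mem _ hA.one_mem)
  have hGL : lipNumber α G = lipNumber α v := by
    rw [lipNumber_add_smul_one, lipNumber_smul, Complex.norm_I, one_mul, h]
  obtain ⟨c, hc, hnorm, hlip⟩ := hv.exists_add_eq hA.le_lipSpace hG
  have hcI : c = Complex.I := by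
    refine eq_I_of_lipNumber_add_eq (hA.le_lipSpace hv.mem) hv0 hc ?_
    rw [← lipNumber_add_smul_one _ 1, add_right_comm, hlip, hGL, two_mul]
  rw [← one_mul ‖v‖, ← hc, ← norm_smul] at hnorm
  obtain ⟨x, y, hGxy, -, hray⟩ := exists_sameRay_of_norm_add_eq hnorm
  have hre : (v x y).re = 0 := re_eq_zero_of_sameRay
    ((norm_apply_apply_le v x y).trans_lt (hv.norm_lt_one_of_lipNumber_ne_zero hv0))
    (by simpa [G, hcI] using hray)
  have hG1 : ‖G‖ = 1 := by rw [← hGxy]; simp [G, hre]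
  have hre0 : postComp rePart v = 0 := by
    ext a b
    have hle : 1 + (v a b).re ^ 2 ≤ 1 := by
      have := pow_le_one₀ (n := 2) (norm_nonneg _) ((norm_apply_apply_le G a b).trans_eq hG1)
      simpa [G, Complex.sq_norm, Complex.normSq_apply, ← sq] using this
    have : (v a b).re = 0 := by nlinarith
    simp [this]
  rw [← h, hre0] at hv0
  exact hv0 (lipNumber_const 0)

theorem lipNumber_eq_zero (hu : IsSpear α A u) (hA : IsLipschitzType α A) : lipNumber α u = 0 := by
  have huL := hA.le_lipSpace hu.mem
  obtain ⟨d, hd, hdu : ‖d‖ = lipNumber α u⟩ :=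
    exists_norm_eq_lipNumber_postComp (.id ℝ ℂ) huL
  obtain ⟨μ, hμ, hμd⟩ := RCLike.exists_norm_eq_mul_self d
  have hμL : lipNumber α (μ • u) = lipNumber α u := by rw [lipNumber_smul, hμ, one_mul]
  rw [← hμL]
  refine (hu.smul hμ).lipNumber_eq_zero_of_lipNumber_re_eq hA (le_antisymm ?_ ?_)
  · have hμu := hA.le_lipSpace (hu.smul hμ).mem
    obtain ⟨e, he, heu⟩ := exists_norm_eq_lipNumber_postComp rePart hμu
    calc lipNumber α (postComp rePart (μ • u)) = ‖rePart e‖ := heu.symm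
      _ ≤ ‖e‖ := by simpa using Complex.abs_re_le_norm e
      _ ≤ lipNumber α (μ • u) := norm_le_lipNumber_postComp (.id ℝ ℂ) hμu he
  · calc lipNumber α (μ • u) = ‖rePart (μ * d)‖ := by simp [hμL, ← hdu, ← hμd]
      _ ≤ lipNumber α (postComp rePart (μ • u)) :=
        norm_le_lipNumber_postComp (rePart ∘L .mul ℝ ℂ μ) huL hd

theorem exists_eq_const (hu : IsSpear α A u) (hA : IsLipschitzType α A) :
    ∃ h : C(Y, ℂ), (∀ y, ‖h y‖ = 1) ∧ u = ContinuousMap.const X h := by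
  have hL := hu.lipNumber_eq_zero hA
  obtain ⟨x₀⟩ := ‹Nonempty X›
  refine ⟨u x₀, fun y ↦ ?_, ContinuousMap.ext fun x ↦ sub_eq_zero.1 (norm_le_zero_iff.1 ?_)⟩
  · rw [hu.norm_apply_apply hA, ← hu.sumNorm_eq, sumNorm, hL, add_zero]
  · simpa [hL] using norm_sub_le_lipNumber_mul (hA.le_lipSpace hu.mem) x x₀

end IsSpear

/-- The function `-|Im z|` on the plane. Its composition with `G` makes the real part of `-i G`
nonpositive when added to it, at the cost of lowering `Re G` by `|Im G|`. -/
noncomputable def negAbsIm : C(ℂ, ℂ) := ⟨fun z ↦ ((-|z.im| : ℝ) : ℂ), by fun_prop⟩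

theorem lipschitzWith_negAbsIm : LipschitzWith 1 negAbsIm :=
  LipschitzWith.of_dist_le_mul fun z w ↦
    calc dist (negAbsIm z) (negAbsIm w) = |(-|z.im|) - (-|w.im|)| :=
          Complex.isometry_ofReal.dist_eq _ _
      _ = |(|w.im| - |z.im|)| := by rw [neg_sub_neg]
      _ ≤ |(w - z).im| := by simpa using abs_abs_sub_abs_le w.im z.im
      _ ≤ 1 * dist z w := by
        rw [one_mul, dist_comm, dist_eq_norm]
        exact Complex.abs_im_le_norm _

section UnitalIsometry

variable {X₁ X₂ Y₁ Y₂ : Type*} [MetricSpace X₁] [CompactSpace X₁] [MetricSpace X₂]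
  [CompactSpace X₂] [TopologicalSpace Y₁] [CompactSpace Y₁] [TopologicalSpace Y₂] [CompactSpace Y₂]
  {α : ℝ} {A₁ : Submodule ℂ C(X₁, C(Y₁, ℂ))} {A₂ : Submodule ℂ C(X₂, C(Y₂, ℂ))}
  {U : A₁ ≃ₗ[ℂ] A₂}

/-- `U` is a linear isometry for the sum norms between two spaces of Lipschitz type, and `U 1 = 1`:
the normalization of a general isometry. -/
structure IsUnitalIsometry (α : ℝ) (U : A₁ ≃ₗ[ℂ] A₂) : Prop where
  left : IsLipschitzType α A₁
  right : IsLipschitzType α A₂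
  sumNorm_map : ∀ F : A₁, sumNorm α (U F).1 = sumNorm α F.1
  map_one : U ⟨1, left.one_mem⟩ = ⟨1, right.one_mem⟩

theorem tendsto_sumNorm_add_smul_one_sub {X Y : Type*} [MetricSpace X] [CompactSpace X]
    [TopologicalSpace Y] [CompactSpace Y] [Nonempty X] [Nonempty Y] (F : C(X, C(Y, ℂ))) :
    Tendsto (fun M : ℝ ↦ sumNorm α (F + (M : ℂ) • 1) - M) atTop
      (𝓝 (reMax F + lipNumber α F)) := by
  simp only [sumNorm, lipNumber_add_smul_one, add_sub_right_comm]
  exact (tendsto_norm_add_smul_one_sub F).add_const _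

namespace IsUnitalIsometry

theorem symm (hU : IsUnitalIsometry α U) : IsUnitalIsometry α U.symm where
  left := hU.right
  right := hU.left
  sumNorm_map F := by rw [← hU.sumNorm_map, U.apply_symm_apply]
  map_one := by rw [LinearEquiv.symm_apply_eq, hU.map_one]

variable [Nonempty X₁] [Nonempty X₂] [Nonempty Y₁] [Nonempty Y₂]

theorem reMax_add_lipNumber_map (hU : IsUnitalIsometry α U) (F : A₁) :
    reMax (U F).1 + lipNumber α (U F).1 = reMax F.1 + lipNumber α F.1 := by
  refine tendsto_nhds_unique ?_ (tendsto_sumNorm_add_smul_one_sub F.1)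
  have hmap : ∀ M : ℝ, sumNorm α (F.1 + (M : ℂ) • 1) = sumNorm α ((U F).1 + (M : ℂ) • 1) :=
    fun M ↦ by
      have h := hU.sumNorm_map (F + (M : ℂ) • ⟨1, hU.left.one_mem⟩)
      rw [map_add, map_smul, hU.map_one] at h
      exact h.symm
  simpa only [hmap] using tendsto_sumNorm_add_smul_one_sub (U F).1

theorem reMax_smul_add_lipNumber_map (hU : IsUnitalIsometry α U) (F : A₁) (z : ℂ) :
    reMax (z • (U F).1) + ‖z‖ * lipNumber α (U F).1 =
      reMax (z • F.1) + ‖z‖ * lipNumber α F.1 := by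
  simpa [lipNumber_smul] using hU.reMax_add_lipNumber_map (z • F)

theorem reMax_sub_reMax_smul_map (hU : IsUnitalIsometry α U) (F : A₁) {z : ℂ} (hz : ‖z‖ = 1) :
    reMax (U F).1 - reMax (z • (U F).1) = reMax F.1 - reMax (z • F.1) := by
  have h := hU.reMax_smul_add_lipNumber_map F z
  rw [hz, one_mul, one_mul] at h
  linarith [hU.reMax_add_lipNumber_map F]

variable {F : A₁}

theorem reMax_smul_map_of_isRealValued (hU : IsUnitalIsometry α U) (hF : IsRealValued F.1) {z : ℂ}
    (hz : 0 ≤ z.re) : reMax (z • (U F).1) =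
      z.re * reMax F.1 + ‖z‖ * (lipNumber α F.1 - lipNumber α (U F).1) := by
  have h := hU.reMax_smul_add_lipNumber_map F z
  rw [hF.reMax_smul hz] at h
  linarith

theorem reMax_map_add_le (hU : IsUnitalIsometry α U) (hF : IsRealValued F.1) {V : A₂}
    (hV : IsRealValued V.1) :
    reMax ((U F).1 + V.1) ≤ reMax F.1 + reMax (-Complex.I • (U F).1 + V.1) := by
  set H : A₁ := U.symm V with hH
  set g := (U F).1 with hg
  set c := lipNumber α F.1 - lipNumber α g
  have hFH := hU.reMax_sub_reMax_smul_map (F + H) Complex.norm_I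
  have hFIH := hU.reMax_sub_reMax_smul_map (F + Complex.I • H) (z := -Complex.I) (by simp)
  rw [show (U (F + H)).1 = g + V.1 by simp [hH, hg]] at hFH
  rw [show (U (F + Complex.I • H)).1 = g + Complex.I • V.1 by simp [hH, hg]] at hFIH
  have hIg : reMax (Complex.I • (g + V.1)) = c := by
    rw [reMax_congr (G := Complex.I • g) fun x y ↦ by simp [hV x y]]
    simpa using hU.reMax_smul_map_of_isRealValued hF (z := Complex.I) (by simp)
  have hg1 : reMax (g + Complex.I • V.1) = reMax F.1 + c := by
    rw [reMax_congr (G := (1 : ℂ) • g) fun x y ↦ by simp [hV x y]]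
    simpa using hU.reMax_smul_map_of_isRealValued hF (z := 1) (by simp)
  have hIF : reMax (Complex.I • (F + H).1) = reMax (Complex.I • H.1) :=
    reMax_congr fun x y ↦ by simp [hF x y]
  have hIF' : reMax (-Complex.I • (F + Complex.I • H).1) = reMax H.1 :=
    reMax_congr fun x y ↦ by simp [hF x y]
  have hIg' : reMax (-Complex.I • (g + Complex.I • V.1)) = reMax (-Complex.I • g + V.1) :=
    reMax_congr fun x y ↦ by simp
  rw [hIg, hIF] at hFH
  rw [hg1, hIg', hIF'] at hFIH
  have hsub : reMax (F + H).1 ≤ reMax F.1 + reMax H.1 := reMax_add_le F.1 H.1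
  have hsub' : reMax (F + Complex.I • H).1 ≤ reMax F.1 + reMax (Complex.I • H.1) :=
    reMax_add_le F.1 (Complex.I • H.1)
  linarith

theorem re_map_le_reMax_add_abs_im (hU : IsUnitalIsometry α U) (hF : IsRealValued F.1) (x : X₂)
    (y : Y₂) : ((U F).1 x y).re ≤ reMax F.1 + |((U F).1 x y).im| := by
  have hV := hU.right.postComp_mem lipschitzWith_negAbsIm (U F).2
  have hle := hU.reMax_map_add_le hF (V := ⟨_, hV⟩) fun a b ↦ Complex.ofReal_im _
  have hneg : reMax (-Complex.I • (U F).1 + postComp negAbsIm (U F).1) ≤ 0 := reMax_le fun a b ↦ by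
    simpa [negAbsIm] using le_abs_self _
  have hxy := re_le_reMax ((U F).1 + postComp negAbsIm (U F).1) x y
  simp only [ContinuousMap.add_apply, postComp_apply, negAbsIm, ContinuousMap.coe_mk,
    Complex.add_re, Complex.ofReal_re] at hxy hle hneg
  linarith

theorem lipNumber_map_of_isRealValued (hU : IsUnitalIsometry α U) (hF : IsRealValued F.1) :
    lipNumber α (U F).1 = lipNumber α F.1 := by
  set c := lipNumber α F.1 - lipNumber α (U F).1
  obtain ⟨x, y, hxy⟩ := exists_re_eq_reMax (U F).1
  have hmax : reMax (U F).1 = reMax F.1 + c := by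
    simpa using hU.reMax_smul_map_of_isRealValued hF (z := 1) (by simp)
  have hcim : c ≤ |((U F).1 x y).im| := by linarith [hU.re_map_le_reMax_add_abs_im hF x y]
  -- The supremum of `Re (z U F)` grows by `|z| c`; `|4 ± 3i| = 5` is less than the `4 c + 3 c`
  -- which the value at `(x, y)` forces.
  have hrot : ∀ s : ℝ, s ^ 2 = 1 → -(3 * s * ((U F).1 x y).im) ≤ c := fun s hs ↦ by
    have hnorm : ‖(⟨4, 3 * s⟩ : ℂ)‖ = 5 := by
      rw [Complex.norm_def, Real.sqrt_eq_iff_mul_self_eq_of_pos (by norm_num)]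
      simp only [Complex.normSq_mk]
      linarith
    have hle := re_le_reMax ((⟨4, 3 * s⟩ : ℂ) • (U F).1) x y
    rw [hU.reMax_smul_map_of_isRealValued hF (by norm_num), hnorm, ContinuousMap.smul_apply,
      ContinuousMap.smul_apply, smul_eq_mul, Complex.mul_re] at hle
    linarith
  have hc0 : c = 0 := by
    have := hrot 1 (by norm_num)
    have := hrot (-1) (by norm_num)
    rcases abs_cases ((U F).1 x y).im with h | h <;> linarith
  linarith

theorem reMax_map_of_isRealValued (hU : IsUnitalIsometry α U) (hF : IsRealValued F.1) :
    reMax (U F).1 = reMax F.1 := by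
  simpa [hU.lipNumber_map_of_isRealValued hF] using hU.reMax_add_lipNumber_map F

theorem isRealValued_map (hU : IsUnitalIsometry α U) (hF : IsRealValued F.1) :
    IsRealValued (U F).1 := by
  have hI : ∀ s : ℝ, ∀ x y, s * -((U F).1 x y).im ≤ 0 := fun s x y ↦ by
    have := hU.reMax_smul_map_of_isRealValued hF (z := s * Complex.I) (by simp)
    have := re_le_reMax ((s * Complex.I) • (U F).1) x y
    simp_all [hU.lipNumber_map_of_isRealValued hF]
  intro x y
  linarith [hI 1 x y, hI (-1) x y]

end IsUnitalIsometry

end UnitalIsometry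

section Representation

variable {X Y : Type*} [MetricSpace X] [TopologicalSpace Y]

/-- The truncated distance `min (dist x a) r` to the point `a`. The truncation bounds the Hölder
constant of exponent `α` by `r ^ (1 - α)`. -/
noncomputable def truncDist (a : X) (r : ℝ) : C(X, ℂ) :=
  ⟨fun x ↦ ((min (dist x a) r : ℝ) : ℂ), by fun_prop⟩

theorem norm_truncDist_sub (a : X) (r : ℝ) (x x' : X) :
    ‖truncDist a r x - truncDist a r x'‖ = |min (dist x a) r - min (dist x' a) r| :=
  (dist_eq_norm _ _).symm.trans (Complex.isometry_ofReal.dist_eq _ _)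

theorem norm_truncDist_sub_le_dist (a : X) (r : ℝ) (x x' : X) :
    ‖truncDist a r x - truncDist a r x'‖ ≤ dist x x' := by
  rw [norm_truncDist_sub]
  refine (abs_min_sub_min_le_max _ _ _ _).trans ?_
  simpa using abs_dist_sub_le x x' a

theorem norm_truncDist_sub_le (a : X) {r : ℝ} (hr : 0 ≤ r) (x x' : X) :
    ‖truncDist a r x - truncDist a r x'‖ ≤ r := by
  rw [norm_truncDist_sub]
  exact abs_sub_le_of_nonneg_of_le (le_min dist_nonneg hr) (min_le_right _ _)
    (le_min dist_nonneg hr) (min_le_right _ _)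

variable [CompactSpace Y] {α : ℝ} {A : Submodule ℂ C(X, C(Y, ℂ))}

theorem lipNumber_ofFst_truncDist_le (hα : 0 ≤ α) (hα1 : α ≤ 1) (a : X) {r : ℝ} (hr : 0 ≤ r) :
    lipNumber α (ofFst Y (truncDist a r)) ≤ r ^ (1 - α) :=
  lipNumber_le (by positivity) <| norm_sub_le_of_apply (by positivity) fun x x' _ ↦
    le_rpow_one_sub_mul_rpow (norm_nonneg _) (norm_truncDist_sub_le a hr x x')
      (norm_truncDist_sub_le_dist a r x x') hα hα1

namespace IsLipschitzType

theorem ofFst_truncDist_mem (hA : IsLipschitzType α A) (a : X) (r : ℝ) :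
    ofFst Y (truncDist a r) ∈ A :=
  hA.ofFst_mem (κ := 1) <| LipschitzWith.of_dist_le_mul fun x x' ↦ by
    simpa [dist_eq_norm] using norm_truncDist_sub_le_dist a r x x'

theorem exists_isRealValued_add_I_smul (hA : IsLipschitzType α A) (F : A) :
    ∃ P Q : A, IsRealValued P.1 ∧ IsRealValued Q.1 ∧ P + Complex.I • Q = F := by
  refine ⟨⟨postComp rePart F.1, hA.postComp_mem rePart.lipschitz F.2⟩,
    ⟨postComp rePart (-Complex.I • F.1),
      hA.postComp_mem rePart.lipschitz (A.smul_mem _ F.2)⟩,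
    fun _ _ ↦ Complex.ofReal_im _, fun _ _ ↦ Complex.ofReal_im _, Subtype.ext ?_⟩
  ext x y
  apply Complex.ext <;> simp

variable [T2Space Y]

theorem eq_of_forall_apply_eq (hA : IsLipschitzType α A) {p q : X × Y}
    (h : ∀ F ∈ A, F p.1 p.2 = F q.1 q.2) : p = q := by
  refine Prod.ext ?_ ?_
  · simpa [truncDist, eq_comm] using h _ (hA.ofFst_truncDist_mem p.1 (dist q.1 p.1))
  · by_contra hne
    obtain ⟨g, -, hg0, hg1⟩ := exists_real_separating hne
    simpa [hg0, hg1] using h _ (hA.const_mem g)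

variable [CompactSpace X]

-- By compactness, evaluation on `A` embeds `X × Y` as a closed subspace of a product of planes.
theorem continuous_of_forall_apply (hA : IsLipschitzType α A) {Z : Type*} [TopologicalSpace Z]
    {Φ : Z → X × Y} (h : ∀ F ∈ A, Continuous fun z ↦ F (Φ z).1 (Φ z).2) : Continuous Φ := by
  let ev : X × Y → A → ℂ := fun p F ↦ F.1 p.1 p.2
  have hev : Continuous ev := continuous_pi fun F ↦ by fun_prop
  have hinj : Function.Injective ev := fun p q hpq ↦
    hA.eq_of_forall_apply_eq fun F hF ↦ congrFun hpq ⟨F, hF⟩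
  exact (hev.isClosedEmbedding hinj).isEmbedding.continuous_iff.2
    (continuous_pi fun F ↦ h F.1 F.2)

end IsLipschitzType

/-- The function `-‖z - c‖` on the plane; composing `F` with it, for `c` a value of `F`, gives a
function that peaks where `F` takes the value `c`. -/
noncomputable def negDist (c : ℂ) : C(ℂ, ℂ) := ⟨fun z ↦ ((-‖z - c‖ : ℝ) : ℂ), by fun_prop⟩

theorem lipschitzWith_negDist (c : ℂ) : LipschitzWith 1 (negDist c) :=
  LipschitzWith.of_dist_le_mul fun z w ↦
    calc dist (negDist c z) (negDist c w) = |(-‖z - c‖) - (-‖w - c‖)| :=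
          Complex.isometry_ofReal.dist_eq _ _
      _ = |‖w - c‖ - ‖z - c‖| := by rw [neg_sub_neg]
      _ ≤ 1 * dist z w := by
        simpa [dist_comm z, dist_eq_norm] using abs_norm_sub_norm_le (w - c) (z - c)

theorem exists_homeomorph_snd_eq {X₁ X₂ Y₁ Y₂ : Type*} [TopologicalSpace X₁] [TopologicalSpace X₂]
    [TopologicalSpace Y₁] [TopologicalSpace Y₂] [Nonempty X₁] [Nonempty X₂]
    (Φ : X₂ × Y₂ ≃ₜ X₁ × Y₁) (h : ∀ x x' y, (Φ (x, y)).2 = (Φ (x', y)).2)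
    (h' : ∀ a a' b, (Φ.symm (a, b)).2 = (Φ.symm (a', b)).2) :
    ∃ τ : Y₂ ≃ₜ Y₁, ∀ x y, (Φ (x, y)).2 = τ y := by
  obtain ⟨x₀⟩ := ‹Nonempty X₂›
  obtain ⟨a₀⟩ := ‹Nonempty X₁›
  refine ⟨⟨⟨fun y ↦ (Φ (x₀, y)).2, fun b ↦ (Φ.symm (a₀, b)).2, fun y ↦ ?_, fun b ↦ ?_⟩,
    by fun_prop, by fun_prop⟩, fun x y ↦ h x x₀ y⟩
  · simp only [h' a₀ (Φ (x₀, y)).1, Prod.mk.eta, Homeomorph.symm_apply_apply]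
  · simp only [h x₀ (Φ.symm (a₀, b)).1, Prod.mk.eta, Homeomorph.apply_symm_apply]

namespace IsUnitalIsometry

variable {X₁ X₂ Y₁ Y₂ : Type*} [MetricSpace X₁] [CompactSpace X₁] [MetricSpace X₂]
  [CompactSpace X₂] [TopologicalSpace Y₁] [CompactSpace Y₁] [TopologicalSpace Y₂] [CompactSpace Y₂]
  [Nonempty X₁] [Nonempty X₂] [Nonempty Y₁] [Nonempty Y₂]
  {α : ℝ} {A₁ : Submodule ℂ C(X₁, C(Y₁, ℂ))} {A₂ : Submodule ℂ C(X₂, C(Y₂, ℂ))}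
  {U : A₁ ≃ₗ[ℂ] A₂}

-- A point where the image of the sum of the given functions peaks is a peak point of each image.
theorem exists_forall_re_map_eq_reMax (hU : IsUnitalIsometry α U) (p : X₁ × Y₁) (s : Finset A₁)
    (hs : ∀ F ∈ s, IsRealValued F.1 ∧ (F.1 p.1 p.2).re = reMax F.1) :
    ∃ q : X₂ × Y₂, ∀ F ∈ s, ((U F).1 q.1 q.2).re = reMax F.1 := by
  have happly : ∀ (a : X₁) (b : Y₁), (∑ F ∈ s, F).1 a b = ∑ F ∈ s, F.1 a b := fun a b ↦ by
    simp [ContinuousMap.sum_apply]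
  have hreal : IsRealValued (∑ F ∈ s, F).1 := fun a b ↦ by
    rw [happly, Complex.im_sum]
    exact Finset.sum_eq_zero fun F hF ↦ (hs F hF).1 a b
  obtain ⟨x, y, hxy⟩ := exists_re_eq_reMax (U (∑ F ∈ s, F)).1
  have hmap : ((U (∑ F ∈ s, F)).1 x y).re = ∑ F ∈ s, ((U F).1 x y).re := by
    rw [show U (∑ F ∈ s, F) = ∑ F ∈ s, U F from map_sum U.toLinearMap _ s]
    simp [ContinuousMap.sum_apply]
  have hle : ∀ F ∈ s, ((U F).1 x y).re ≤ reMax F.1 := fun F hF ↦ by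
    rw [← hU.reMax_map_of_isRealValued (hs F hF).1]
    exact re_le_reMax _ x y
  have hsum : ∑ F ∈ s, reMax F.1 ≤ ∑ F ∈ s, ((U F).1 x y).re :=
    calc ∑ F ∈ s, reMax F.1 = ((∑ F ∈ s, F).1 p.1 p.2).re := by
          rw [happly, Complex.re_sum]
          exact Finset.sum_congr rfl fun F hF ↦ (hs F hF).2.symm
      _ ≤ reMax (∑ F ∈ s, F).1 := re_le_reMax _ _ _
      _ = ∑ F ∈ s, ((U F).1 x y).re := by rw [← hmap, hxy, hU.reMax_map_of_isRealValued hreal]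
  exact ⟨(x, y), (Finset.sum_eq_sum_iff_of_le hle).1 ((Finset.sum_le_sum hle).antisymm hsum)⟩

theorem exists_common_peak_point (hU : IsUnitalIsometry α U) (p : X₁ × Y₁) :
    ∃ q : X₂ × Y₂, ∀ F : A₁, IsRealValued F.1 → (F.1 p.1 p.2).re = reMax F.1 →
      ((U F).1 q.1 q.2).re = reMax F.1 := by
  let P : Set A₁ := {F | IsRealValued F.1 ∧ (F.1 p.1 p.2).re = reMax F.1}
  obtain ⟨q, hq⟩ := CompactSpace.iInter_nonempty
    (t := fun F : P ↦ {q : X₂ × Y₂ | ((U F.1).1 q.1 q.2).re = reMax F.1.1})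
    (fun F ↦ isClosed_eq (by fun_prop) continuous_const) fun s ↦ by
      obtain ⟨q, hq⟩ := hU.exists_forall_re_map_eq_reMax p
        (s.map (Function.Embedding.subtype _)) (by simp_all [P])
      exact ⟨q, mem_iInter₂.2 fun F hF ↦ hq F.1 (Finset.mem_map_of_mem _ hF)⟩
  exact ⟨q, fun F hF hpeak ↦ mem_iInter.1 hq ⟨F, hF, hpeak⟩⟩

theorem exists_point_of_isRealValued (hU : IsUnitalIsometry α U) (p : X₁ × Y₁) :
    ∃ q : X₂ × Y₂, ∀ F : A₁, IsRealValued F.1 → (U F).1 q.1 q.2 = F.1 p.1 p.2 := by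
  obtain ⟨q, hq⟩ := hU.exists_common_peak_point p
  refine ⟨q, fun F hF ↦ Complex.ext ?_ ?_⟩
  · let c := F.1 p.1 p.2
    -- Both `P = -‖F - c‖` and `F + P` peak at `p`.
    let P : A₁ := ⟨postComp (negDist c) F.1, hU.left.postComp_mem (lipschitzWith_negDist c) F.2⟩
    have hPre : ∀ a b, (P.1 a b).re = -‖F.1 a b - c‖ := fun a b ↦ Complex.ofReal_re _
    have hPreal : IsRealValued P.1 := fun a b ↦ Complex.ofReal_im _
    have hPmax : (P.1 p.1 p.2).re = reMax P.1 :=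
      (re_le_reMax _ _ _).antisymm <| reMax_le fun a b ↦ by
        rw [hPre, hPre, sub_self, norm_zero, neg_zero]
        exact neg_nonpos.2 (norm_nonneg _)
    have hsum : ∀ a b, ((F + P).1 a b).re = (F.1 a b).re - ‖F.1 a b - c‖ := fun a b ↦ by
      rw [sub_eq_add_neg, ← hPre]
      rfl
    have hsummax : ((F + P).1 p.1 p.2).re = reMax (F + P).1 :=
      (re_le_reMax _ _ _).antisymm <| reMax_le fun a b ↦ by
        rw [hsum, hsum, sub_self, norm_zero, sub_zero, sub_le_iff_le_add, ← sub_le_iff_le_add']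
        exact Complex.re_le_norm (F.1 a b - c)
    have hUP := hq P hPreal hPmax
    have hUsum := hq (F + P) (fun a b ↦ by simp [hF a b, hPreal a b]) hsummax
    rw [← hPmax] at hUP
    rw [← hsummax, map_add] at hUsum
    simpa [hUP] using hUsum
  · rw [hU.isRealValued_map hF, hF]

theorem exists_point (hU : IsUnitalIsometry α U) (p : X₁ × Y₁) :
    ∃ q : X₂ × Y₂, ∀ F : A₁, (U F).1 q.1 q.2 = F.1 p.1 p.2 := by
  obtain ⟨q, hq⟩ := hU.exists_point_of_isRealValued p
  refine ⟨q, fun F ↦ ?_⟩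
  obtain ⟨P, Q, hP, hQ, rfl⟩ := hU.left.exists_isRealValued_add_I_smul F
  simp [hq P hP, hq Q hQ]

section

variable {Φ : X₂ × Y₂ → X₁ × Y₁}

-- The distance to `φ (x', y)` truncated at `r = dist (φ (x, y)) (φ (x', y))` has Lipschitz number
-- at most `r ^ (1 - α)`, so that `r ≤ r ^ (1 - α) * dist x x' ^ α`.
theorem dist_fst_le (hU : IsUnitalIsometry α U) (hα : 0 < α) (hα1 : α ≤ 1)
    (hΦ : ∀ (F : A₁) q, (U F).1 q.1 q.2 = F.1 (Φ q).1 (Φ q).2) (x x' : X₂) (y : Y₂) :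
    dist (Φ (x, y)).1 (Φ (x', y)).1 ≤ dist x x' := by
  set r := dist (Φ (x, y)).1 (Φ (x', y)).1 with hr
  obtain hr0 | hr0 := dist_nonneg.eq_or_lt' (a := r)
  · exact hr0.trans_le dist_nonneg
  let F : A₁ := ⟨_, hU.left.ofFst_truncDist_mem (Φ (x', y)).1 r⟩
  have hlip : lipNumber α (U F).1 ≤ r ^ (1 - α) := by
    rw [hU.lipNumber_map_of_isRealValued fun _ _ ↦ Complex.ofReal_im _]
    exact lipNumber_ofFst_truncDist_le hα.le hα1 _ hr0.le
  have hsub : ‖(U F).1 x y - (U F).1 x' y‖ = r := by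
    rw [hΦ F (x, y), hΦ F (x', y), ofFst_apply, ofFst_apply, norm_truncDist_sub]
    simp [← hr, hr0.le]
  have hpow : r ^ (1 - α) * r ^ α ≤ r ^ (1 - α) * dist x x' ^ α :=
    calc r ^ (1 - α) * r ^ α = r := by
          rw [← Real.rpow_add hr0, sub_add_cancel, Real.rpow_one]
      _ ≤ lipNumber α (U F).1 * dist x x' ^ α :=
          hsub.symm.trans_le (norm_apply_sub_le_lipNumber_mul (hU.right.le_lipSpace (U F).2) x x' y)
      _ ≤ r ^ (1 - α) * dist x x' ^ α := by gcongr
  exact (Real.rpow_le_rpow_iff hr0.le dist_nonneg hα).1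
    (le_of_mul_le_mul_left hpow (by positivity))

theorem snd_eq_snd [T2Space Y₁] (hU : IsUnitalIsometry α U)
    (hΦ : ∀ (F : A₁) q, (U F).1 q.1 q.2 = F.1 (Φ q).1 (Φ q).2) (x x' : X₂) (y : Y₂) :
    (Φ (x, y)).2 = (Φ (x', y)).2 := by
  by_contra hne
  obtain ⟨g, hg, hg0, hg1⟩ := exists_real_separating hne
  let F : A₁ := ⟨.const X₁ g, hU.left.const_mem g⟩
  have hlip : lipNumber α (U F).1 = 0 := by
    rw [hU.lipNumber_map_of_isRealValued fun _ ↦ hg, lipNumber_const]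
  have hzero := norm_apply_sub_le_lipNumber_mul (hU.right.le_lipSpace (U F).2) x x' y
  rw [hlip, hΦ F (x, y), hΦ F (x', y)] at hzero
  norm_num [F, hg0, hg1] at hzero

end

variable [T2Space Y₁] [T2Space Y₂]

theorem exists_homeomorph (hU : IsUnitalIsometry α U) :
    ∃ Φ : X₂ × Y₂ ≃ₜ X₁ × Y₁, ∀ (F : A₁) q, (U F).1 q.1 q.2 = F.1 (Φ q).1 (Φ q).2 := by
  choose Ψ hΨ using hU.exists_point
  choose Φ hΦ using hU.symm.exists_point
  have hUΦ : ∀ (F : A₁) q, F.1 (Φ q).1 (Φ q).2 = (U F).1 q.1 q.2 := fun F q ↦ by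
    rw [← hΦ, U.symm_apply_apply]
  have hUΨ : ∀ (G : A₂) p, G.1 (Ψ p).1 (Ψ p).2 = (U.symm G).1 p.1 p.2 := fun G p ↦ by
    rw [← hΨ, U.apply_symm_apply]
  refine ⟨⟨⟨Φ, Ψ, fun q ↦ ?_, fun p ↦ ?_⟩, ?_, ?_⟩, fun F q ↦ (hUΦ F q).symm⟩
  · exact hU.right.eq_of_forall_apply_eq fun G hG ↦ (hUΨ ⟨G, hG⟩ _).trans (hΦ q _)
  · exact hU.left.eq_of_forall_apply_eq fun F hF ↦ (hUΦ ⟨F, hF⟩ _).trans (hΨ p _)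
  · exact hU.left.continuous_of_forall_apply fun F hF ↦ by
      simp only [hUΦ ⟨F, hF⟩]
      fun_prop
  · exact hU.right.continuous_of_forall_apply fun G hG ↦ by
      simp only [hUΨ ⟨G, hG⟩]
      fun_prop

theorem exists_isWeightedComposition (hU : IsUnitalIsometry α U) (hα : 0 < α) (hα1 : α ≤ 1) :
    ∃ φ τ, IsWeightedComposition U 1 φ τ := by
  obtain ⟨Φ, hΦ⟩ := hU.exists_homeomorph
  have hΦ' : ∀ (G : A₂) p, (U.symm G).1 p.1 p.2 = G.1 (Φ.symm p).1 (Φ.symm p).2 := fun G p ↦ by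
    simpa using (hΦ (U.symm G) (Φ.symm p)).symm
  obtain ⟨τ, hτ⟩ := exists_homeomorph_snd_eq Φ (hU.snd_eq_snd hΦ) (hU.symm.snd_eq_snd hΦ')
  have hΦτ : ∀ x y, Φ (x, y) = ((Φ (x, y)).1, τ y) := fun x y ↦ Prod.ext rfl (hτ x y)
  refine ⟨⟨fun q ↦ (Φ q).1, by fun_prop⟩, τ, fun _ ↦ norm_one, fun y ↦ ⟨?_, fun a ↦ ?_⟩,
    fun F x y ↦ ?_⟩
  · refine Isometry.of_dist_eq fun x x' ↦ (hU.dist_fst_le hα hα1 hΦ x x' y).antisymm ?_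
    have hle := hU.symm.dist_fst_le hα hα1 hΦ' (Φ (x, y)).1 (Φ (x', y)).1 (τ y)
    rwa [← hΦτ, ← hΦτ, Φ.symm_apply_apply, Φ.symm_apply_apply] at hle
  · have hsnd : (Φ.symm (a, τ y)).2 = y := τ.injective <| by
      rw [← hτ (Φ.symm (a, τ y)).1, Prod.mk.eta, Φ.apply_symm_apply]
    refine ⟨(Φ.symm (a, τ y)).1, ?_⟩
    change (Φ ((Φ.symm (a, τ y)).1, y)).1 = a
    nth_rw 2 [← hsnd]
    rw [Prod.mk.eta, Φ.apply_symm_apply]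
  · rw [hΦ F (x, y), hτ]
    exact (one_mul _).symm

end IsUnitalIsometry

end Representation

namespace IsSurjectiveSumNormIsometry

section

variable {K₁ K₂ K₃ E₁ E₂ E₃ : Type*} [MetricSpace K₁] [CompactSpace K₁] [MetricSpace K₂]
  [CompactSpace K₂] [MetricSpace K₃] [CompactSpace K₃] [NormedAddCommGroup E₁] [NormedSpace ℂ E₁]
  [NormedAddCommGroup E₂] [NormedSpace ℂ E₂] [NormedAddCommGroup E₃] [NormedSpace ℂ E₃] {α : ℝ}
  {A₁ : Submodule ℂ C(K₁, E₁)} {A₂ : Submodule ℂ C(K₂, E₂)} {A₃ : Submodule ℂ C(K₃, E₃)}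
  {U : A₁ → A₂} {V : A₂ → A₃}

theorem injective (hU : IsSurjectiveSumNormIsometry α A₁ A₂ U) : Function.Injective U :=
  (injective_iff_map_eq_zero hU.1.mk').2 fun F hF ↦ Subtype.ext <| sumNorm_eq_zero_iff.1 <|
    (hU.2.2 F).symm.trans (sumNorm_eq_zero_iff.2 (congrArg Subtype.val hF))

theorem exists_linearEquiv (hU : IsSurjectiveSumNormIsometry α A₁ A₂ U) :
    ∃ L : A₁ ≃ₗ[ℂ] A₂, ⇑L = U :=
  ⟨.ofBijective hU.1.mk' ⟨hU.injective, hU.2.1⟩, rfl⟩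

theorem comp (hV : IsSurjectiveSumNormIsometry α A₂ A₃ V)
    (hU : IsSurjectiveSumNormIsometry α A₁ A₂ U) : IsSurjectiveSumNormIsometry α A₁ A₃ (V ∘ U) :=
  ⟨(hV.1.mk'.comp hU.1.mk').isLinear, hV.2.1.comp hU.2.1, fun F ↦
    (hV.2.2 (U F)).trans (hU.2.2 F)⟩

end

end IsSurjectiveSumNormIsometry

section Unimodular

variable {X Y : Type*} [MetricSpace X] [TopologicalSpace Y] [CompactSpace Y] {α : ℝ}
  {A : Submodule ℂ C(X, C(Y, ℂ))} {h : C(Y, ℂ)}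

theorem norm_weightedComp_fst_sub_le (hh : ∀ y, ‖h y‖ = 1) (F : C(X, C(Y, ℂ))) (x x' : X) :
    ‖weightedComp h .fst (.id Y) F x - weightedComp h .fst (.id Y) F x'‖ ≤ ‖F x - F x'‖ :=
  (ContinuousMap.norm_le _ (norm_nonneg _)).2 fun y ↦
    (norm_weightedComp_sub_apply hh x x' y).trans_le ((F x - F x').norm_coe_le_norm y)

namespace IsLipschitzType

theorem weightedComp_fst_mem (hA : IsLipschitzType α A) (hh : ∀ y, ‖h y‖ = 1) {F : C(X, C(Y, ℂ))}
    (hF : F ∈ A) : weightedComp h .fst (.id Y) F ∈ A :=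
  hA.mem_of_norm_sub_le hF (norm_weightedComp_fst_sub_le hh F)

theorem exists_isSurjectiveSumNormIsometry_star_mul [CompactSpace X]
    (hA : IsLipschitzType α A) (hh : ∀ y, ‖h y‖ = 1) :
    ∃ M : A → A, IsSurjectiveSumNormIsometry α A A M ∧
      ∀ (F : A) x y, (M F).1 x y = star (h y) * F.1 x y := by
  have hh' : ∀ y, ‖star h y‖ = 1 := fun y ↦ (norm_star _).trans (hh y)
  refine ⟨fun F ↦ ⟨_, hA.weightedComp_fst_mem hh' F.2⟩,
    IsWeightedComposition.isSurjectiveSumNormIsometry (h := star h) (φ := .fst) (τ := .refl Y)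
      ⟨hh', isFiberwiseIsometry_fst, fun F x y ↦ rfl⟩ hA.le_lipSpace fun W hW ↦
        ⟨_, hA.weightedComp_fst_mem hh hW, ?_⟩, fun F x y ↦ rfl⟩
  ext x y
  change star (h y) * (h y * W x y) = W x y
  rw [← mul_assoc, star_mul_self_of_norm_eq_one (hh y), one_mul]

theorem subsingleton_iff_isEmpty [Nonempty X] (hA : IsLipschitzType α A) :
    Subsingleton A ↔ IsEmpty Y := by
  refine ⟨fun hsub ↦ ⟨fun y ↦ ?_⟩, fun hY ↦ ⟨fun F G ↦ Subtype.ext ?_⟩⟩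
  · obtain ⟨x⟩ := ‹Nonempty X›
    have hone : (⟨1, hA.one_mem⟩ : A) = 0 := Subsingleton.elim _ _
    simpa using congrArg (fun F : A ↦ F.1 x y) hone
  · ext x y
    exact isEmptyElim y

end IsLipschitzType

end Unimodular

section Representation

variable {X₁ X₂ Y₁ Y₂ : Type*} [MetricSpace X₁] [CompactSpace X₁] [Nonempty X₁] [MetricSpace X₂]
  [CompactSpace X₂] [Nonempty X₂] [TopologicalSpace Y₁] [CompactSpace Y₁] [T2Space Y₁]
  [TopologicalSpace Y₂] [CompactSpace Y₂] [T2Space Y₂] {α : ℝ}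
  {A₁ : Submodule ℂ C(X₁, C(Y₁, ℂ))} {A₂ : Submodule ℂ C(X₂, C(Y₂, ℂ))} {U : A₁ → A₂}

namespace IsSurjectiveSumNormIsometry

theorem exists_isWeightedComposition_of_nonempty [Nonempty Y₁] [Nonempty Y₂]
    (hU : IsSurjectiveSumNormIsometry α A₁ A₂ U) (hα : 0 < α) (hα1 : α ≤ 1)
    (hA₁ : IsLipschitzType α A₁) (hA₂ : IsLipschitzType α A₂) :
    ∃ h φ τ, IsWeightedComposition U h φ τ := by
  obtain ⟨h, hh, hU1⟩ := ((isSpear_one hA₁).map (u := ⟨1, hA₁.one_mem⟩) hU).exists_eq_const hA₂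
  obtain ⟨M, hM, hMapply⟩ := hA₂.exists_isSurjectiveSumNormIsometry_star_mul hh
  obtain ⟨V, hV⟩ := (hM.comp hU).exists_linearEquiv
  have hV1 : V ⟨1, hA₁.one_mem⟩ = ⟨1, hA₂.one_mem⟩ := by
    ext x y
    rw [hV, Function.comp_apply, hMapply, hU1]
    exact star_mul_self_of_norm_eq_one (hh y)
  obtain ⟨φ, τ, -, hφ, hVapply⟩ := IsUnitalIsometry.exists_isWeightedComposition (U := V)
    ⟨hA₁, hA₂, fun F ↦ hV ▸ (hM.comp hU).2.2 F, hV1⟩ hα hα1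
  refine ⟨h, φ, τ, hh, hφ, fun F x y ↦ ?_⟩
  have hstar : star (h y) * (U F).1 x y = F.1 (φ (x, y)) (τ y) := by
    have hVF := hVapply F x y
    rw [hV] at hVF
    exact (hMapply _ _ _).symm.trans (hVF.trans (one_mul _))
  rw [← hstar, ← mul_assoc, mul_comm (h y), star_mul_self_of_norm_eq_one (hh y), one_mul]

theorem exists_isWeightedComposition (hU : IsSurjectiveSumNormIsometry α A₁ A₂ U) (hα : 0 < α)
    (hα1 : α ≤ 1) (hA₁ : IsLipschitzType α A₁) (hA₂ : IsLipschitzType α A₂) :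
    ∃ h φ τ, IsWeightedComposition U h φ τ := by
  have hempty : IsEmpty Y₁ ↔ IsEmpty Y₂ := by
    rw [← hA₁.subsingleton_iff_isEmpty, ← hA₂.subsingleton_iff_isEmpty]
    exact (Equiv.ofBijective U ⟨hU.injective, hU.2.1⟩).subsingleton_congr
  cases isEmpty_or_nonempty Y₂ with
  | inl hY₂ =>
    have := hempty.2 hY₂
    obtain ⟨x⟩ := ‹Nonempty X₁›
    exact ⟨1, .const _ x, .empty, isEmptyElim, fun y ↦ isEmptyElim y, fun _ _ y ↦ isEmptyElim y⟩
  | inr hY₂ =>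
    have : Nonempty Y₁ := not_isEmpty_iff.1 (mt hempty.1 (not_isEmpty_iff.2 hY₂))
    exact hU.exists_isWeightedComposition_of_nonempty hα hα1 hA₁ hA₂

end IsSurjectiveSumNormIsometry

end Representation

section Bump

variable {X : Type*} [MetricSpace X] {α δ : ℝ} {c x x' : X}

/-- The cone of height `δ ^ α` over the ball of radius `δ` around `c`: the height is the largest one
for which the Hölder constant of exponent `α` stays bounded by `1`. -/
noncomputable def bump (α δ : ℝ) (c x : X) : ℝ :=
  δ ^ (α - 1) * max 0 (δ - dist x c)

theorem rpow_sub_one_mul_self (hδ : 0 < δ) : δ ^ (α - 1) * δ = δ ^ α := by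
  rw [← Real.rpow_add_one hδ.ne', sub_add_cancel]

theorem bump_nonneg (hδ : 0 < δ) : 0 ≤ bump α δ c x := by
  unfold bump
  positivity

theorem bump_self (hδ : 0 < δ) : bump α δ c c = δ ^ α := by
  rw [bump, dist_self, sub_zero, max_eq_right hδ.le, rpow_sub_one_mul_self hδ]

theorem bump_le_rpow (hδ : 0 < δ) : bump α δ c x ≤ δ ^ α := by
  rw [bump, ← rpow_sub_one_mul_self (α := α) hδ]
  gcongr
  exact max_le hδ.le (sub_le_self _ dist_nonneg)

theorem bump_eq_zero (h : δ ≤ dist x c) : bump α δ c x = 0 := by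
  rw [bump, max_eq_left (sub_nonpos.2 h), mul_zero]

theorem bump_le_add_mul (hδ : 0 < δ) : bump α δ c x ≤ bump α δ c x' + δ ^ (α - 1) * dist x x' := by
  rw [bump, bump, ← mul_add]
  gcongr
  have htri := dist_triangle_left x' c x
  have hmax := le_max_right 0 (δ - dist x' c)
  exact max_le (by positivity) (by linarith)

theorem bump_le_add_rpow (hα : 0 < α) (hα1 : α ≤ 1) (hδ : 0 < δ) :
    bump α δ c x ≤ bump α δ c x' + dist x x' ^ α := by
  rcases le_total δ (dist x x') with h | h
  · exact (bump_le_rpow hδ).trans <| (Real.rpow_le_rpow hδ.le h hα.le).trans <|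
      le_add_of_nonneg_left (bump_nonneg hδ)
  · rcases (dist_nonneg (x := x) (y := x')).eq_or_lt with h0 | h0
    · simp [dist_eq_zero.1 h0.symm, Real.zero_rpow hα.ne']
    · refine (bump_le_add_mul (x' := x') hδ).trans ?_
      rw [← rpow_sub_one_mul_self h0]
      gcongr _ + ?_ * _
      exact Real.rpow_le_rpow_of_nonpos h0 h (sub_nonpos.2 hα1)

end Bump

section GlidingHump

open Asymptotics

variable {X : Type*} [MetricSpace X] {α : ℝ} {p : X} {c q : ℕ → X}

/-- Centres `c n` of bumps of radii `dist (q n) (c n)`, converging to `p` so fast that the bumps are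
disjoint and their radii are `O(dist (c n) p ^ 2)`. -/
structure IsGlidingHump (p : X) (c q : ℕ → X) : Prop where
  center_pos : ∀ n, 0 < dist (c n) p
  center_le_one : ∀ n, dist (c n) p ≤ 1
  center_le_half : ∀ m n, m < n → dist (c n) p ≤ dist (c m) p / 2
  radius_pos : ∀ n, 0 < dist (q n) (c n)
  radius_le : ∀ n, dist (q n) (c n) ≤ dist (c n) p ^ 2 / 8

/-- The supremum of the bumps with centres `c n` and radii `dist (q n) (c n)`: a little Lipschitz
function that oscillates by `dist (q n) (c n) ^ α` between `c n` and `q n`. -/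
noncomputable def humpSup (α : ℝ) (c q : ℕ → X) (x : X) : ℝ :=
  ⨆ n, bump α (dist (q n) (c n)) (c n) x

namespace IsGlidingHump

theorem radius_le_center (H : IsGlidingHump p c q) (n : ℕ) :
    dist (q n) (c n) ≤ dist (c n) p / 8 := by
  nlinarith [H.radius_le n, H.center_pos n, H.center_le_one n]

theorem center_le_pow (H : IsGlidingHump p c q) (n : ℕ) : dist (c n) p ≤ (1 / 2) ^ n := by
  induction n with
  | zero => simpa using H.center_le_one 0
  | succ n ih =>
    rw [pow_succ]
    linarith [H.center_le_half n (n + 1) n.lt_succ_self]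

theorem tendsto_center (H : IsGlidingHump p c q) : Tendsto (fun n ↦ dist (c n) p) atTop (𝓝 0) :=
  squeeze_zero (fun _ ↦ dist_nonneg) H.center_le_pow <|
    tendsto_pow_atTop_nhds_zero_of_lt_one (by norm_num) (by norm_num)

theorem tendsto_radius (H : IsGlidingHump p c q) :
    Tendsto (fun n ↦ dist (q n) (c n)) atTop (𝓝 0) :=
  squeeze_zero (fun _ ↦ dist_nonneg) H.radius_le_center <| by
    simpa using H.tendsto_center.div_const 8

theorem radius_le_dist (H : IsGlidingHump p c q) (m n : ℕ) :
    dist (q m) (c m) ≤ dist (q n) (c m) := by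
  have hm := H.radius_le_center m
  have hn := H.radius_le_center n
  rcases lt_trichotomy m n with h | rfl | h
  · have htri := dist_triangle4 (c m) (q n) (c n) p
    rw [dist_comm (c m) (q n)] at htri
    have hhalf := H.center_le_half m n h
    have hpos := H.center_pos m
    linarith
  · exact le_rfl
  · have htri := dist_triangle4 (c n) (q n) (c m) p
    rw [dist_comm (c n) (q n)] at htri
    have hhalf := H.center_le_half n m h
    have hpos := H.center_pos n
    linarith

theorem bump_le_humpSup (H : IsGlidingHump p c q) (hα : 0 < α) (n : ℕ) (x : X) :
    bump α (dist (q n) (c n)) (c n) x ≤ humpSup α c q x := by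
  refine le_ciSup (f := fun n ↦ bump α (dist (q n) (c n)) (c n) x) ⟨1, ?_⟩ n
  rintro _ ⟨m, rfl⟩
  have hle : dist (q m) (c m) ≤ 1 := by linarith [H.radius_le_center m, H.center_le_one m]
  exact (bump_le_rpow (H.radius_pos m)).trans (Real.rpow_le_one dist_nonneg hle hα.le)

theorem humpSup_nonneg (H : IsGlidingHump p c q) (x : X) : 0 ≤ humpSup α c q x :=
  Real.iSup_nonneg fun n ↦ bump_nonneg (H.radius_pos n)

theorem humpSup_center_ge (H : IsGlidingHump p c q) (hα : 0 < α) (n : ℕ) :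
    dist (q n) (c n) ^ α ≤ humpSup α c q (c n) :=
  (bump_self (H.radius_pos n)).symm.trans_le (H.bump_le_humpSup hα n (c n))

theorem humpSup_eq_zero {x : X} (h : ∀ n, dist (q n) (c n) ≤ dist x (c n)) :
    humpSup α c q x = 0 := by
  simp [humpSup, bump_eq_zero (h _)]

theorem abs_humpSup_sub_le (H : IsGlidingHump p c q) (hα : 0 < α) (hα1 : α ≤ 1) (x x' : X) :
    |humpSup α c q x - humpSup α c q x'| ≤ dist x x' ^ α := by
  have hle : ∀ x x', humpSup α c q x ≤ humpSup α c q x' + dist x x' ^ α := fun x x' ↦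
    ciSup_le fun n ↦ (bump_le_add_rpow hα hα1 (H.radius_pos n)).trans
      (add_le_add_left (H.bump_le_humpSup hα n x') _)
  exact abs_sub_le_iff.2 ⟨sub_le_iff_le_add'.2 (hle x x'),
    sub_le_iff_le_add'.2 (dist_comm x x' ▸ hle x' x)⟩

theorem humpSup_le_sq_rpow (H : IsGlidingHump p c q) (hα : 0 < α) (x : X) :
    humpSup α c q x ≤ (dist p x ^ 2) ^ α := by
  refine ciSup_le fun n ↦ ?_
  rcases le_or_gt (dist (q n) (c n)) (dist x (c n)) with h | h
  · exact (bump_eq_zero h).trans_le (by positivity)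
  · have htri := dist_triangle_left (c n) p x
    rw [dist_comm x p] at htri
    have hrad := H.radius_le_center n
    have hle : dist (q n) (c n) ≤ dist p x ^ 2 := by
      nlinarith [H.radius_le n, H.center_pos n]
    exact (bump_le_rpow (H.radius_pos n)).trans (Real.rpow_le_rpow dist_nonneg hle hα.le)

theorem exists_eventually_bump_eq_zero (H : IsGlidingHump p c q) {x₀ : X} (hx₀ : x₀ ≠ p) :
    ∃ N, ∀ᶠ x in 𝓝 x₀, ∀ n ≥ N, bump α (dist (q n) (c n)) (c n) x = 0 := by
  have hpos : 0 < dist x₀ p / 4 := by simpa using hx₀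
  obtain ⟨N, hN⟩ := eventually_atTop.1 (H.tendsto_center.eventually (gt_mem_nhds hpos))
  refine ⟨N, ?_⟩
  filter_upwards [Metric.ball_mem_nhds x₀ hpos] with x hx n hn
  have htri := dist_triangle4 x₀ x (c n) p
  rw [dist_comm x₀ x] at htri
  refine bump_eq_zero ?_
  linarith [hN n hn, H.radius_le_center n, Metric.mem_ball.1 hx]

theorem isBigO_humpSup_sub (H : IsGlidingHump p c q) (hα : 0 < α) {x₀ : X} (hx₀ : x₀ ≠ p) :
    (fun x ↦ humpSup α c q x₀ - humpSup α c q x) =O[𝓝 x₀] fun x ↦ dist x₀ x := by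
  obtain ⟨N, hN⟩ := H.exists_eventually_bump_eq_zero (α := α) hx₀
  set C := ∑ n ∈ Finset.range N, dist (q n) (c n) ^ (α - 1)
  have hle : ∀ x x', (∀ n ≥ N, bump α (dist (q n) (c n)) (c n) x = 0) →
      humpSup α c q x ≤ humpSup α c q x' + C * dist x x' := fun x x' hx ↦ by
    refine ciSup_le fun n ↦ ?_
    rcases lt_or_ge n N with hn | hn
    · refine (bump_le_add_mul (x' := x') (H.radius_pos n)).trans ?_
      gcongr
      · exact H.bump_le_humpSup hα n x'
      · exact Finset.single_le_sum (f := fun n ↦ dist (q n) (c n) ^ (α - 1))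
          (fun n _ ↦ by positivity) (Finset.mem_range.2 hn)
    · rw [hx n hn]
      have := H.humpSup_nonneg (α := α) x'
      positivity
  refine .of_bound C ?_
  filter_upwards [hN] with x hx
  rw [Real.norm_eq_abs, Real.norm_of_nonneg dist_nonneg, abs_sub_le_iff]
  exact ⟨sub_le_iff_le_add'.2 (hle x₀ x hN.self_of_nhds),
    sub_le_iff_le_add'.2 (dist_comm x₀ x ▸ hle x x₀ hx)⟩

theorem isLittleO_humpSup_sub (H : IsGlidingHump p c q) (hα : 0 < α) (hα1 : α < 1) (x₀ : X) :
    (fun x ↦ humpSup α c q x₀ - humpSup α c q x) =o[𝓝 x₀] fun x ↦ dist x₀ x ^ α := by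
  rcases eq_or_ne x₀ p with rfl | hx₀
  · have hzero : humpSup α c q x₀ = 0 := humpSup_eq_zero fun n ↦ by
      rw [dist_comm x₀]
      linarith [H.radius_le_center n, H.center_pos n]
    have hsq : (fun x ↦ dist x₀ x ^ α * dist x₀ x ^ α) =o[𝓝 x₀] fun x ↦ dist x₀ x ^ α := by
      simpa using ((isLittleO_one_iff ℝ).2 (tendsto_dist_rpow hα x₀)).mul_isBigO
        (isBigO_refl (fun x ↦ dist x₀ x ^ α) (𝓝 x₀))
    refine (IsBigO.of_bound' (.of_forall fun x ↦ ?_)).trans_isLittleO hsq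
    rw [hzero, zero_sub, norm_neg, Real.norm_of_nonneg (H.humpSup_nonneg x),
      Real.norm_of_nonneg (by positivity), ← Real.mul_rpow dist_nonneg dist_nonneg, ← sq]
    exact H.humpSup_le_sq_rpow hα x
  · exact (H.isBigO_humpSup_sub hα hx₀).trans_isLittleO (isLittleO_dist_rpow hα1 x₀)

theorem exists_mem_littleLipSpace (H : IsGlidingHump p c q) (hα : 0 < α) (hα1 : α < 1) :
    ∃ f ∈ LittleLipSpace α X ℂ, ∀ n, dist (q n) (c n) ^ α ≤ ‖f (c n) - f (q n)‖ := by
  have hlittle := H.isLittleO_humpSup_sub hα hα1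
  have hcont : Continuous (humpSup α c q) := continuous_iff_continuousAt.2 fun x₀ ↦ by
    simpa [ContinuousAt] using
      ((hlittle x₀).isBigO.trans_tendsto (tendsto_dist_rpow hα x₀)).const_sub (humpSup α c q x₀)
  refine ⟨⟨fun x ↦ (humpSup α c q x : ℂ), by fun_prop⟩, mem_littleLipSpace_iff_isLittleO.2
    ⟨mem_lipSpace_of_norm_sub_le zero_le_one fun x x' ↦ ?_, fun x₀ ↦ ?_⟩, fun n ↦ ?_⟩
  · rw [one_mul, ContinuousMap.coe_mk, ← Complex.ofReal_sub, Complex.norm_real]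
    exact H.abs_humpSup_sub_le hα hα1.le x x'
  · refine (IsBigO.of_bound' (.of_forall fun x ↦ ?_)).trans_isLittleO (hlittle x₀)
    rw [ContinuousMap.coe_mk, ← Complex.ofReal_sub, Complex.norm_real]
  · rw [ContinuousMap.coe_mk, ← Complex.ofReal_sub, Complex.norm_real,
      humpSup_eq_zero fun m ↦ H.radius_le_dist m n, sub_zero]
    exact (H.humpSup_center_ge hα n).trans (le_abs_self _)

end IsGlidingHump

end GlidingHump

section LocallyConstant

variable {X₁ X₂ Y₁ Y₂ : Type*} [MetricSpace X₁] [MetricSpace X₂] [TopologicalSpace Y₁]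
  [TopologicalSpace Y₂] {α : ℝ} {h : C(Y₂, ℂ)} {φ : C(X₂ × Y₂, X₁)}

theorem exists_seq_dist_le_half {f : Y₂ → X₁} {y₀ : Y₂} (hf : ContinuousAt f y₀)
    (hne : ∃ᶠ y in 𝓝 y₀, f y ≠ f y₀) :
    ∃ y : ℕ → Y₂, (∀ n, 0 < dist (f (y n)) (f y₀) ∧ dist (f (y n)) (f y₀) ≤ 1) ∧
      ∀ m n, m < n → dist (f (y n)) (f y₀) ≤ dist (f (y m)) (f y₀) / 2 := by
  have hlim := tendsto_iff_dist_tendsto_zero.1 hf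
  refine exists_seq_of_forall_finset_exists
    (fun y ↦ 0 < dist (f y) (f y₀) ∧ dist (f y) (f y₀) ≤ 1)
    (fun y y' ↦ dist (f y') (f y₀) ≤ dist (f y) (f y₀) / 2) fun s hs ↦ ?_
  have hsmall : ∀ᶠ y in 𝓝 y₀, ∀ x ∈ s, dist (f y) (f y₀) ≤ dist (f x) (f y₀) / 2 :=
    s.eventually_all.2 fun x hx ↦ hlim.eventually_le_const (half_pos (hs x hx).1)
  obtain ⟨y, hy, hy1, hys⟩ :=
    (hne.and_eventually ((hlim.eventually_le_const one_pos).and hsmall)).exists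
  exact ⟨y, ⟨dist_pos.2 hy, hy1⟩, hys⟩

theorem IsFiberwiseIsometry.exists_dist_le (hφ : IsFiberwiseIsometry φ) {x₀ : X₂} {y₀ : Y₂}
    (hne : ∃ᶠ y in 𝓝 y₀, φ (x₀, y) ≠ φ (x₀, y₀)) {ε : ℝ} (hε : 0 < ε) :
    ∃ z, 0 < dist z x₀ ∧ dist z x₀ ≤ ε := by
  have hcont : Continuous fun y ↦ φ (x₀, y) := by fun_prop
  obtain ⟨y, hy, hyε⟩ := (hne.and_eventually
    ((hcont.tendsto y₀).eventually (Metric.closedBall_mem_nhds _ hε))).exists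
  obtain ⟨z, hz : φ (z, y₀) = φ (x₀, y)⟩ := (hφ y₀).2 (φ (x₀, y))
  have hdist : dist z x₀ = dist (φ (x₀, y)) (φ (x₀, y₀)) := by
    rw [← (hφ y₀).1.dist_eq, hz]
  exact ⟨z, hdist ▸ dist_pos.2 hy, hdist ▸ hyε⟩

theorem IsFiberwiseIsometry.exists_isGlidingHump (hφ : IsFiberwiseIsometry φ) {x₀ : X₂} {y₀ : Y₂}
    (hne : ∃ᶠ y in 𝓝 y₀, φ (x₀, y) ≠ φ (x₀, y₀)) :
    ∃ (y : ℕ → Y₂) (z : ℕ → X₂),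
      IsGlidingHump (φ (x₀, y₀)) (fun n ↦ φ (x₀, y n)) fun n ↦ φ (z n, y n) := by
  obtain ⟨y, hy, hhalf⟩ := exists_seq_dist_le_half (f := fun y ↦ φ (x₀, y)) (by fun_prop) hne
  have hradius : ∀ n, 0 < dist (φ (x₀, y n)) (φ (x₀, y₀)) ^ 2 / 8 := fun n ↦
    div_pos (pow_pos (hy n).1 2) (by norm_num)
  choose z hz0 hzle using fun n ↦ hφ.exists_dist_le hne (hradius n)
  have hdist : ∀ n, dist (φ (z n, y n)) (φ (x₀, y n)) = dist (z n) x₀ := fun n ↦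
    (hφ (y n)).1.dist_eq _ _
  exact ⟨y, z, fun n ↦ (hy n).1, fun n ↦ (hy n).2, hhalf, fun n ↦ (hdist n).symm ▸ hz0 n,
    fun n ↦ (hdist n).trans_le (hzle n)⟩

theorem isLocallyConstant_of_leftInverse {τ : Y₂ ≃ₜ Y₁} {ψ : C(X₁ × Y₁, X₂)}
    (hψ : IsFiberwiseIsometry ψ) (hψφ : ∀ x y, ψ (φ (x, y), τ y) = x)
    (hφ : ∀ x, IsLocallyConstant fun y ↦ φ (x, y)) (a : X₁) :
    IsLocallyConstant fun y ↦ ψ (a, y) := by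
  have hcomp : IsLocallyConstant fun y ↦ ψ (a, τ y) := by
    refine (IsLocallyConstant.iff_eventually_eq _).2 fun y₀ ↦ ?_
    have hright : φ (ψ (a, τ y₀), y₀) = a := (hψ (τ y₀)).1.injective (hψφ _ _)
    filter_upwards [(hφ (ψ (a, τ y₀))).eventually_eq y₀] with y hy
    rw [← hψφ (ψ (a, τ y₀)) y, hy, hright]
  simpa [Function.comp_def] using hcomp.comp_continuous τ.symm.continuous

variable [CompactSpace Y₁] [CompactSpace Y₂] {τ : C(Y₂, Y₁)}

theorem IsFiberwiseIsometry.isLocallyConstant_of_mem_littleLipSpace (hφ : IsFiberwiseIsometry φ)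
    (hα : 0 < α) (hα1 : α < 1) (hh : ∀ y, ‖h y‖ = 1)
    (hmem : ∀ F ∈ LittleLipSpace α X₁ C(Y₁, ℂ),
      weightedComp h φ τ F ∈ LittleLipSpace α X₂ C(Y₂, ℂ)) (x₀ : X₂) :
    IsLocallyConstant fun y ↦ φ (x₀, y) := by
  refine (IsLocallyConstant.iff_eventually_eq _).2 fun y₀ ↦ by_contra fun hne ↦ ?_
  obtain ⟨y, z, H⟩ := hφ.exists_isGlidingHump (not_eventually.1 hne)
  obtain ⟨f, hf, hfle⟩ := H.exists_mem_littleLipSpace hα hα1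
  have hdist : ∀ n, dist (φ (z n, y n)) (φ (x₀, y n)) = dist x₀ (z n) := fun n ↦
    ((hφ (y n)).1.dist_eq _ _).trans (dist_comm _ _)
  have hfF : ∀ x x', ‖ofFst Y₁ f x - ofFst Y₁ f x'‖ ≤ ‖f x - f x'‖ := fun x x' ↦
    (ContinuousMap.norm_le _ (norm_nonneg _)).2 fun _ ↦ le_rfl
  have hlittle := (mem_littleLipSpace_iff_isLittleO.1
    (hmem _ (mem_littleLipSpace_of_norm_sub_le hf hfF))).2 x₀
  have hz : Tendsto z atTop (𝓝 x₀) := tendsto_iff_dist_tendsto_zero.2 <|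
    H.tendsto_radius.congr fun n ↦ (hdist n).trans (dist_comm _ _)
  obtain ⟨n, hn⟩ := (hz.eventually (hlittle.bound one_half_pos)).exists
  set W := weightedComp h φ τ (ofFst Y₁ f) with hW
  have hlower : dist x₀ (z n) ^ α ≤ ‖W x₀ - W (z n)‖ :=
    calc dist x₀ (z n) ^ α ≤ ‖f (φ (x₀, y n)) - f (φ (z n, y n))‖ := hdist n ▸ hfle n
      _ = ‖W x₀ (y n) - W (z n) (y n)‖ := by
        rw [hW, norm_weightedComp_sub_apply hh, ofFst_apply, ofFst_apply]
      _ ≤ ‖W x₀ - W (z n)‖ := (W x₀ - W (z n)).norm_coe_le_norm (y n)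
  have hpos : 0 < dist x₀ (z n) ^ α := Real.rpow_pos_of_pos (hdist n ▸ H.radius_pos n) α
  rw [Real.norm_of_nonneg hpos.le] at hn
  linarith

theorem weightedComp_mem_littleLipSpace (hh : ∀ y, ‖h y‖ = 1) (hφ : IsFiberwiseIsometry φ)
    (hconst : ∀ x, IsLocallyConstant fun y ↦ φ (x, y)) {F : C(X₁, C(Y₁, ℂ))}
    (hF : F ∈ LittleLipSpace α X₁ C(Y₁, ℂ)) :
    weightedComp h φ τ F ∈ LittleLipSpace α X₂ C(Y₂, ℂ) := by
  refine mem_littleLipSpace_iff_isLittleO.2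
    ⟨weightedComp_mem_lipSpace hh hφ hF.1, fun x₀ ↦ Asymptotics.isLittleO_iff.2 fun ε hε ↦ ?_⟩
  have hlocal : ∀ y₀, ∀ᶠ p : X₂ × Y₂ in 𝓝 (x₀, y₀),
      ‖F (φ (x₀, p.2)) - F (φ p)‖ ≤ ε * ‖dist x₀ p.1 ^ α‖ := fun y₀ ↦ by
    have hbound := (φ.continuous.tendsto (x₀, y₀)).eventually
      (((mem_littleLipSpace_iff_isLittleO.1 hF).2 (φ (x₀, y₀))).bound hε)
    filter_upwards [hbound, continuous_snd.continuousAt.eventually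
      ((hconst x₀).eventually_eq y₀)] with p hp hpconst
    rw [← hpconst, (hφ p.2).1.dist_eq] at hp
    exact hp
  filter_upwards [isCompact_univ.eventually_forall_of_forall_eventually
    (P := fun x y ↦ ‖F (φ (x₀, y)) - F (φ (x, y))‖ ≤ ε * ‖dist x₀ x ^ α‖)
    fun y₀ _ ↦ hlocal y₀] with x hx
  refine (ContinuousMap.norm_le _ (by positivity)).2 fun y ↦ ?_
  rw [ContinuousMap.sub_apply, norm_weightedComp_sub_apply hh]
  exact ((F (φ (x₀, y)) - F (φ (x, y))).norm_coe_le_norm (τ y)).trans (hx y (mem_univ y))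

end LocallyConstant

section Characterization

variable {X₁ X₂ Y₁ Y₂ : Type*} [MetricSpace X₁] [CompactSpace X₁] [MetricSpace X₂]
  [CompactSpace X₂] [TopologicalSpace Y₁] [CompactSpace Y₁] [TopologicalSpace Y₂]
  [CompactSpace Y₂] {α : ℝ} {h : C(Y₂, ℂ)} {φ : C(X₂ × Y₂, X₁)} {τ : Y₂ ≃ₜ Y₁}

theorem IsWeightedComposition.isSurjectiveSumNormIsometry_lipSpace
    {U : LipSpace α X₁ C(Y₁, ℂ) → LipSpace α X₂ C(Y₂, ℂ)} (hU : IsWeightedComposition U h φ τ) :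
    IsSurjectiveSumNormIsometry α (LipSpace α X₁ C(Y₁, ℂ)) (LipSpace α X₂ C(Y₂, ℂ)) U := by
  obtain ⟨k, ψ, hk, hψ, -, hinv⟩ := exists_weightedComp_inverse hU.1 hU.2.1 τ
  exact hU.isSurjectiveSumNormIsometry le_rfl fun W hW ↦
    ⟨_, weightedComp_mem_lipSpace hk hψ hW, hinv W⟩

theorem IsWeightedComposition.isSurjectiveSumNormIsometry_littleLipSpace (hα : 0 < α) (hα1 : α < 1)
    {U : LittleLipSpace α X₁ C(Y₁, ℂ) → LittleLipSpace α X₂ C(Y₂, ℂ)}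
    (hU : IsWeightedComposition U h φ τ) :
    IsSurjectiveSumNormIsometry α (LittleLipSpace α X₁ C(Y₁, ℂ))
      (LittleLipSpace α X₂ C(Y₂, ℂ)) U := by
  obtain ⟨k, ψ, hk, hψ, hψφ, hinv⟩ := exists_weightedComp_inverse hU.1 hU.2.1 τ
  have hφ : ∀ x, IsLocallyConstant fun y ↦ φ (x, y) :=
    hU.2.1.isLocallyConstant_of_mem_littleLipSpace hα hα1 hU.1 fun F hF ↦
      hU.coe_apply ⟨F, hF⟩ ▸ (U ⟨F, hF⟩).2
  exact hU.isSurjectiveSumNormIsometry littleLipSpace_le_lipSpace fun W hW ↦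
    ⟨_, weightedComp_mem_littleLipSpace hk hψ (isLocallyConstant_of_leftInverse hψ hψφ hφ) hW,
      hinv W⟩

end Characterization

theorem corollary8p1_general {X₁ X₂ Y₁ Y₂ : Type*}
    [MetricSpace X₁] [CompactSpace X₁] [Nonempty X₁]
    [MetricSpace X₂] [CompactSpace X₂] [Nonempty X₂]
    [TopologicalSpace Y₁] [CompactSpace Y₁] [T2Space Y₁]
    [TopologicalSpace Y₂] [CompactSpace Y₂] [T2Space Y₂] {α : ℝ} (hα : 0 < α) (hα1 : α ≤ 1) :
    (∀ U : LipSpace α X₁ C(Y₁, ℂ) → LipSpace α X₂ C(Y₂, ℂ),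
      IsSurjectiveSumNormIsometry α (LipSpace α X₁ C(Y₁, ℂ)) (LipSpace α X₂ C(Y₂, ℂ)) U ↔
        ∃ h φ τ, IsWeightedComposition U h φ τ) ∧
    (α < 1 → ∀ U : LittleLipSpace α X₁ C(Y₁, ℂ) → LittleLipSpace α X₂ C(Y₂, ℂ),
      IsSurjectiveSumNormIsometry α (LittleLipSpace α X₁ C(Y₁, ℂ))
        (LittleLipSpace α X₂ C(Y₂, ℂ)) U ↔ ∃ h φ τ, IsWeightedComposition U h φ τ) := by
  refine ⟨fun U ↦ ⟨fun hU ↦ ?_, fun ⟨h, φ, τ, hU⟩ ↦ ?_⟩,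
    fun hlt U ↦ ⟨fun hU ↦ ?_, fun ⟨h, φ, τ, hU⟩ ↦ ?_⟩⟩
  · exact hU.exists_isWeightedComposition hα hα1 (isLipschitzType_lipSpace hα hα1)
      (isLipschitzType_lipSpace hα hα1)
  · exact hU.isSurjectiveSumNormIsometry_lipSpace
  · exact hU.exists_isWeightedComposition hα hα1 (isLipschitzType_littleLipSpace hα hlt)
      (isLipschitzType_littleLipSpace hα hlt)
  · exact hU.isSurjectiveSumNormIsometry_littleLipSpace hα hlt

theorem corollary8p1 {X₁ X₂ Y₁ Y₂ : Type*}
    [MetricSpace X₁] [CompactSpace X₁] [Nonempty X₁]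
    [MetricSpace X₂] [CompactSpace X₂] [Nonempty X₂]
    [TopologicalSpace Y₁] [CompactSpace Y₁] [T2Space Y₁]
    [TopologicalSpace Y₂] [CompactSpace Y₂] [T2Space Y₂] :
    (∀ U : LipSpace 1 X₁ C(Y₁, ℂ) → LipSpace 1 X₂ C(Y₂, ℂ),
      IsSurjectiveSumNormIsometry 1 (LipSpace 1 X₁ C(Y₁, ℂ)) (LipSpace 1 X₂ C(Y₂, ℂ)) U ↔
        ∃ (h : C(Y₂, ℂ)) (φ : C(X₂ × Y₂, X₁)) (τ : Y₂ ≃ₜ Y₁),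
          (∀ y : Y₂, ‖h y‖ = 1) ∧
          (∀ y : Y₂, Isometry (fun x : X₂ => φ (x, y)) ∧
            Function.Surjective (fun x : X₂ => φ (x, y))) ∧
          ∀ (F : LipSpace 1 X₁ C(Y₁, ℂ)) (x : X₂) (y : Y₂),
            (U F : C(X₂, C(Y₂, ℂ))) x y =
              h y * (F : C(X₁, C(Y₁, ℂ))) (φ (x, y)) (τ y)) ∧
    (∀ α : ℝ, 0 < α → α < 1 →
      ∀ U : LittleLipSpace α X₁ C(Y₁, ℂ) → LittleLipSpace α X₂ C(Y₂, ℂ),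
        IsSurjectiveSumNormIsometry α
            (LittleLipSpace α X₁ C(Y₁, ℂ)) (LittleLipSpace α X₂ C(Y₂, ℂ)) U ↔
          ∃ (h : C(Y₂, ℂ)) (φ : C(X₂ × Y₂, X₁)) (τ : Y₂ ≃ₜ Y₁),
            (∀ y : Y₂, ‖h y‖ = 1) ∧
            (∀ y : Y₂, Isometry (fun x : X₂ => φ (x, y)) ∧
              Function.Surjective (fun x : X₂ => φ (x, y))) ∧
            ∀ (F : LittleLipSpace α X₁ C(Y₁, ℂ)) (x : X₂) (y : Y₂),
              (U F : C(X₂, C(Y₂, ℂ))) x y =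
                h y * (F : C(X₁, C(Y₁, ℂ))) (φ (x, y)) (τ y)) :=
  ⟨(corollary8p1_general one_pos le_rfl).1, fun _ hα hα1 ↦
    (corollary8p1_general hα hα1.le).2 hα1⟩
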